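/- Speculation can be unprofitable in a first-price procurement auction. **The game.** $N$ sellers each own one item; their values are i.i.d. on $[0,1]$ with CDF $F$. A speculator with no item and value $0$ for any item offers every seller the price $p\in[0,r]$ for his item. The sellers simultaneously accept or reject; a seller with value $v$ who accepts gets $p-v$. Then a buyer procures one item in a first-price sealed-bid auction with reserve price $r\in(0,1]$ among the $m$ sellers who rejected and, if somebody accepted, the speculator, who enters one item; $m$ and the speculator's presence are publicly known. Bids are nonnegative, the lowest bid wins if it is at most $r$, ties are broken uniformly; a winning bid $b$ gives $b-v$ to a seller of value $v$ and $b$ to the speculator, losers get $0$. If nobody accepts, the speculator gets $0$; otherwise his profit is his auction payoff minus $p$ times the number of acceptances. We consider symmetric perfect Bayesian equilibria after the offer $p$: sellers use the same (possibly randomized) acceptance rule and the same pure bidding functions, never bid below their values, and the speculator may randomize his bids; beliefs about rejecting sellers follow Bayes' rule; bids are optimal after every public history for every seller type that rejects with positive probability and for the speculator; the acceptance decision of every type is optimal given that a seller who rejects best-responds in the auction. An equilibrium has cutoff $v^\star$ if, up to a null set of values, a seller accepts if and only if $v_i<v^\star$. For $v\in[0,r]$ let $G(b;v)=\frac{F(b)-F(v)}{1-F(v)}$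 and $\underline b(m,v)=\max_{v\le b\le r}b\,[1-G(b;v)]^m$ (at $F(v)=1$, read $\underline b(m,v)=r$), and put $$p^\star(v)=v+\int_v^r[1-F(x)]^{N-1}dx+\sum_{m=0}^{N-2}\binom{N-1}{m}[1-F(v)]^mF(v)^{N-1-m}\,[\underline b(m+1,v)-v],$$ $$\Pi^\star(v)=\sum_{m=1}^{N-1}\binom Nm[1-F(v)]^mF(v)^{N-m}\,\underline b(m,v)+F(v)^Nr-N\,F(v)\,p^\star(v).$$ **Proposition.** Let $N=2$. There exist $\eta>0$ and $r\in(0,1]$ such that for $F(v)=v^\eta$ on $[0,1]$ the following hold. 1. $\Pi^\star(0)=0$, and $\Pi^\star(v)<0$ for every $v\in(0,r]$. 2. For every $v\in[0,r]$ we have $p^\star(v)\in[0,r]$, and after the offer $p^\star(v)$ there is a symmetric equilibrium with cutoff $v$ in which the speculator's expected profit is $\Pi^\star(v)$. 3. For every $p\in[0,r]$ a symmetric equilibrium exists, and every symmetric equilibrium has a cutoff in $[0,r]$; the speculator's expected profit in it is $0$ if the cutoff is $0$ and negative if the cutoff is positive. 4. Consequently the largest expected profit that the speculator can obtain, over all $p\in[0,r]$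 and all symmetric equilibria after the offer $p$, is $0$. -/

import Mathlib

open MeasureTheory ProbabilityTheory Set

noncomputable section

namespace FPASpeculation

/-! ### The first-price procurement auction -/

open Classical in
/-- Probability that a bid `b` wins a first-price procurement auction with reserve price `r` against
the rival bids `c`: the lowest bid wins provided it does not exceed `r`, and ties are broken
uniformly at random. -/
def winShare {k : ℕ} (r b : ℝ) (c : Fin k → ℝ) : ℝ :=
  if b ≤ r ∧ ∀ i, b ≤ c i then
    1 / (1 + ((Finset.univ.filter fun i => c i = b).card : ℝ))
  else 0

/-- Expected payoff of the speculator (whose value for an item is `0`) from the bid `b` against `m`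
sellers whose values are i.i.d. with law `μ` and who bid according to `β`. -/
def specPayoff (r : ℝ) (μ : Measure ℝ) (m : ℕ) (β : ℝ → ℝ) (b : ℝ) : ℝ :=
  ∫ x, b * winShare r b (fun i => β (x i)) ∂(Measure.pi fun _ : Fin m => μ)

/-- Interim payoff, from the bid `b`, of a seller with value `v` who competes with the speculator,
whose random bid has law `σ`, and with `k` other sellers, whose values are i.i.d. with law `μ` and
who bid according to `β`. The payoff is `b - v` if he wins and `0` otherwise. -/
def sellerPayoffWith (r : ℝ) (μ σ : Measure ℝ) (k : ℕ) (β : ℝ → ℝ) (v b : ℝ) : ℝ :=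
  ∫ s, ∫ x, (b - v) * winShare r b (Fin.cons s (fun i => β (x i)) : Fin (k + 1) → ℝ)
    ∂(Measure.pi fun _ : Fin k => μ) ∂σ

/-- Interim payoff, from the bid `b`, of a seller with value `v` who competes only with `k` other
sellers (the speculator being absent). -/
def sellerPayoffWithout (r : ℝ) (μ : Measure ℝ) (k : ℕ) (β : ℝ → ℝ) (v b : ℝ) : ℝ :=
  ∫ x, (b - v) * winShare r b (fun i => β (x i)) ∂(Measure.pi fun _ : Fin k => μ)

/-- Best payoff over all nonnegative bids. -/
def bestPayoff (U : ℝ → ℝ) : ℝ := sSup (U '' Ici 0)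

/-- `b` is a nonnegative bid that is optimal among all nonnegative bids. -/
def IsBestBid (U : ℝ → ℝ) (b : ℝ) : Prop := 0 ≤ b ∧ ∀ b', 0 ≤ b' → U b' ≤ U b

/-! ### The speculation game following a given acquisition price -/

/-- A symmetric assessment in the game that follows the speculator's price offer.
A public history is a pair (number `m` of sellers in the auction, speculator present or not). -/
structure Assessment where
  /-- probability with which a seller of the given value accepts the offer -/
  accept : ℝ → ℝ
  /-- bid of a seller as a function of his value, with `m` sellers and the speculator present -/
  bidWith : ℕ → ℝ → ℝ
  /-- bid of a seller as a function of his value, with all sellers and no speculator present -/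
  bidWithout : ℝ → ℝ
  /-- law of the bid of the speculator when he faces `m` sellers -/
  specBid : ℕ → Measure ℝ
  /-- belief about the value of a seller who has rejected the offer -/
  belief : Measure ℝ

namespace Assessment

variable (s : Assessment) (N : ℕ) (F : Measure ℝ) (r p : ℝ)

/-- Probability that a given seller accepts the offer. -/
def acceptProb : ℝ := ∫ x, s.accept x ∂F

/-- Value of rejecting the offer for a seller with value `v`: when `k < N - 1` of the other sellers
also reject, he faces the speculator and `k` sellers; when all of the others reject, he faces
`N - 1` sellers and no speculator. He bids optimally in the auction. -/
def rejectValue (v : ℝ) : ℝ :=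
  (∑ k ∈ Finset.range (N - 1),
    ((N - 1).choose k : ℝ) * (1 - s.acceptProb F) ^ k * s.acceptProb F ^ (N - 1 - k) *
      bestPayoff (sellerPayoffWith r s.belief (s.specBid (k + 1)) k (s.bidWith (k + 1)) v))
  + (1 - s.acceptProb F) ^ (N - 1) *
      bestPayoff (sellerPayoffWithout r s.belief (N - 1) s.bidWithout v)

/-- `s` is a symmetric perfect Bayesian equilibrium, in undominated bids, of the game with `N`
sellers, values i.i.d. with law `F` on `[0, 1]`, reserve price `r` and price offer `p`. -/
structure IsSymmetricPBE : Prop where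
  measurable_accept : Measurable s.accept
  measurable_bidWith : ∀ m, Measurable (s.bidWith m)
  measurable_bidWithout : Measurable s.bidWithout
  prob_specBid : ∀ m, IsProbabilityMeasure (s.specBid m)
  prob_belief : IsProbabilityMeasure s.belief
  accept_mem : ∀ v ∈ Icc (0 : ℝ) 1, s.accept v ∈ Icc (0 : ℝ) 1
  /-- beliefs are carried by `[0, 1]` -/
  belief_support : s.belief (Icc 0 1)ᶜ = 0
  /-- Bayes' rule: if rejection has positive probability, then `belief` is the conditional law of
  a seller's value given that he rejects -/
  bayes : F.withDensity (fun x => ENNReal.ofReal (1 - s.accept x)) =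
    ENNReal.ofReal (1 - s.acceptProb F) • s.belief
  /-- accepting is optimal for every type that accepts with positive probability -/
  accept_optimal : ∀ v ∈ Icc (0 : ℝ) 1, 0 < s.accept v → s.rejectValue N F r v ≤ p - v
  /-- rejecting is optimal for every type that rejects with positive probability -/
  reject_optimal : ∀ v ∈ Icc (0 : ℝ) 1, s.accept v < 1 → p - v ≤ s.rejectValue N F r v
  /-- sellers never bid below their values -/
  undominated_with : ∀ m, 1 ≤ m → m < N → ∀ v ∈ Icc (0 : ℝ) 1, v ≤ s.bidWith m v
  undominated_without : ∀ v ∈ Icc (0 : ℝ) 1, v ≤ s.bidWithout v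
  /-- the bids of every type that may reject are optimal after every history -/
  bidWith_optimal : ∀ k, k + 1 < N → ∀ v ∈ Icc (0 : ℝ) 1, s.accept v < 1 →
    IsBestBid (sellerPayoffWith r s.belief (s.specBid (k + 1)) k (s.bidWith (k + 1)) v)
      (s.bidWith (k + 1) v)
  bidWithout_optimal : ∀ v ∈ Icc (0 : ℝ) 1, s.accept v < 1 →
    IsBestBid (sellerPayoffWithout r s.belief (N - 1) s.bidWithout v) (s.bidWithout v)
  /-- the (possibly mixed) bid of the speculator is optimal after every history in which he takes
  part in the auction -/
  specBid_optimal : ∀ m < N, ∀ᵐ b ∂(s.specBid m),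
    IsBestBid (specPayoff r s.belief m (s.bidWith m)) b

/-- Sellers accept if and only if their value lies below `c` (up to an `F`-null set). -/
def HasCutoff (c : ℝ) : Prop := ∀ᵐ x ∂F, s.accept x = if x < c then 1 else 0

/-- Ex ante expected profit of the speculator: the expected auction revenue, over the number `m < N`
of sellers who reject, minus the expected payment to the sellers who accept. -/
def specProfit : ℝ :=
  (∑ m ∈ Finset.range N,
    (N.choose m : ℝ) * (1 - s.acceptProb F) ^ m * s.acceptProb F ^ (N - m) *
      ∫ b, specPayoff r s.belief m (s.bidWith m) b ∂(s.specBid m))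
  - N * s.acceptProb F * p

end Assessment

/-! ### Price and profit as functions of the cutoff -/

/-- The conditional CDF `G(b; v) = (F(b) - F(v)) / (1 - F(v))`. -/
def condCDFAbove (F : Measure ℝ) (v b : ℝ) : ℝ := (cdf F b - cdf F v) / (1 - cdf F v)

/-- The maximum of `b * (1 - G(b; v)) ^ m` over `b ∈ [v, r]`. -/
def lowBid (F : Measure ℝ) (r : ℝ) (m : ℕ) (v : ℝ) : ℝ :=
  sSup ((fun b => b * (1 - condCDFAbove F v b) ^ m) '' Icc v r)

/-- The acquisition price that makes a seller with value `v` indifferent when the cutoff is `v`. -/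
def cutoffPrice (N : ℕ) (F : Measure ℝ) (r v : ℝ) : ℝ :=
  v + (∫ x in v..r, (1 - cdf F x) ^ (N - 1))
    + ∑ m ∈ Finset.range (N - 1),
        ((N - 1).choose m : ℝ) * (1 - cdf F v) ^ m * cdf F v ^ (N - 1 - m) *
          (lowBid F r (m + 1) v - v)

/-- The expected profit of the speculator as a function of the cutoff `v`. -/
def cutoffProfit (N : ℕ) (F : Measure ℝ) (r v : ℝ) : ℝ :=
  (∑ m ∈ Finset.Icc 1 (N - 1),
    (N.choose m : ℝ) * (1 - cdf F v) ^ m * cdf F v ^ (N - m) * lowBid F r m v)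
  + cdf F v ^ N * r - N * cdf F v * cutoffPrice N F r v

end FPASpeculation

end

/-! The witness is the uniform law (`η = 1`) with reserve price 1/3. With two sellers, every
contested auction is a duel, either speculator against seller or seller against seller, so
everything reduces to `duelPayoff` against one bid distribution.

Every equilibrium has a cutoff (`exists_hasCutoff`). The payoff from accepting falls at rate one in
the value, while the payoff from rejecting falls only at the rate of the winning probability. So if
a type accepts, a lower type can reject only if he wins for sure when the speculator is absent,
which happens with probability zero among rejecting types.

Now let the cutoff be v > 0. Write u for the speculator's payoff against one seller, and U₁, U₂ for
the rents of type v with and without the speculator. The profit is at most v²/3 + 2v(1-v)u - 2vp,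
and p ≥ v + vU₁ + (1-v)U₂ because types just below v accept. Three bounds, valid in every
equilibrium, make this negative (`specProfit_neg`): U₁ ≥ u - v (`spec_best_sub_le`); (1-v)u ≤ r(1-r)
= 2/9 (`spec_best_le`); (1-v)U₂ ≥ (1/3-v)(3-v)/4 (`le_best_without`, from an envelope argument). The
rent that must be paid to buy an item thus exceeds what the item can earn.

Existence is explicit. Against the speculator a seller bids 2/(9(1-x)), which keeps the speculator's
payoff b(1-x)/(1-v) constant. Against a seller he bids x plus the integral of (1-t)/(1-x) over [x,
1/3], the usual first-price bid. Values of at least 1/3 bid themselves. Neither formula depends on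
the cutoff. The speculator's mixture is the one that makes the first bid optimal (`exists_specBid`),
and a continuity argument in the cutoff covers all prices. -/

namespace FPASpeculation

/-! ### Reduction of the auctions to duels against one bid distribution -/

/-- Probability that a bid `b` wins under the reserve price `r` against a single rival whose bid has
law `ν`. -/
noncomputable def winProb (r : ℝ) (ν : Measure ℝ) (b : ℝ) : ℝ :=
  if b ≤ r then ν.real (Ioi b) + ν.real {b} / 2 else 0

lemma winShare_one (r b s : ℝ) :
    winShare r b (fun _ : Fin 1 => s) =
      if b ≤ r then (Ioi b).indicator 1 s + ({b} : Set ℝ).indicator (fun _ => 1 / 2) s else 0 := by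
  unfold winShare
  by_cases h : b ≤ r
  · rcases lt_trichotomy b s with hs | hs | hs
    · have : ¬ s = b := hs.ne'
      simp [h, hs.le, hs, this]
    · subst hs
      simp [h]; norm_num
    · have h1 : ¬ b ≤ s := not_le.2 hs
      have h2 : ¬ s = b := hs.ne
      simp [h, h1, hs.le, h2]
  · simp [h]

lemma integral_winShare_one (r b : ℝ) (ν : Measure ℝ) [IsFiniteMeasure ν] :
    ∫ s, winShare r b (fun _ : Fin 1 => s) ∂ν = winProb r ν b := by
  simp only [winShare_one, winProb]
  by_cases h : b ≤ r
  · simp only [h, if_true]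
    rw [integral_add, integral_indicator_one measurableSet_Ioi, integral_indicator_const]
    · simp; ring
    · exact measurableSet_singleton b
    · exact (integrable_const (1 : ℝ)).indicator measurableSet_Ioi
    · exact (integrable_const (1 / 2 : ℝ)).indicator (measurableSet_singleton b)
  · simp [h]

lemma measurable_winShare_one (r b : ℝ) :
    Measurable fun s => winShare r b (fun _ : Fin 1 => s) := by
  simp only [winShare_one]
  by_cases h : b ≤ r
  · simp only [h, if_true]
    exact (measurable_one.indicator measurableSet_Ioi).add
      (measurable_const.indicator (measurableSet_singleton b))
  · simp only [h, if_false]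
    exact measurable_const

lemma sellerPayoffWithout_one (r : ℝ) (μ : Measure ℝ) [IsProbabilityMeasure μ] {β : ℝ → ℝ}
    (hβ : Measurable β) (v b : ℝ) :
    sellerPayoffWithout r μ 1 β v b = (b - v) * winProb r (μ.map β) b := by
  have : IsProbabilityMeasure (μ.map β) := Measure.isProbabilityMeasure_map hβ.aemeasurable
  unfold sellerPayoffWithout
  rw [← integral_winShare_one, integral_map hβ.aemeasurable
    (measurable_winShare_one r b).aestronglyMeasurable, ← integral_const_mul,
    ← (measurePreserving_funUnique μ (Fin 1)).integral_comp
      (MeasurableEquiv.measurableEmbedding _)]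
  refine integral_congr_ae (.of_forall fun x => ?_)
  have : (fun i : Fin 1 => β (x i)) = fun _ => β (x 0) := by
    funext i; rw [Subsingleton.elim i 0]
  simp [this]

lemma specPayoff_one (r : ℝ) (μ : Measure ℝ) [IsProbabilityMeasure μ] {β : ℝ → ℝ}
    (hβ : Measurable β) (b : ℝ) :
    specPayoff r μ 1 β b = b * winProb r (μ.map β) b := by
  have := sellerPayoffWithout_one r μ hβ 0 b
  simpa [sellerPayoffWithout, specPayoff] using this

lemma specPayoff_zero (r : ℝ) (μ : Measure ℝ) [IsProbabilityMeasure μ] (β : ℝ → ℝ) (b : ℝ) :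
    specPayoff r μ 0 β b = if b ≤ r then b else 0 := by
  unfold specPayoff winShare
  simp

lemma sellerPayoffWith_zero (r : ℝ) (μ σ : Measure ℝ) [IsProbabilityMeasure μ]
    [IsProbabilityMeasure σ] (β : ℝ → ℝ) (v b : ℝ) :
    sellerPayoffWith r μ σ 0 β v b = (b - v) * winProb r σ b := by
  unfold sellerPayoffWith
  rw [← integral_winShare_one, ← integral_const_mul]
  refine integral_congr_ae (.of_forall fun s => ?_)
  have : ∀ x : Fin 0 → ℝ, (Fin.cons s (fun i => β (x i)) : Fin 1 → ℝ) = fun _ => s := by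
    intro x; funext i; fin_cases i; rfl
  simp [this]

/-! ### Best replies and rents in a duel -/

section WinProb

variable {r b b' v w : ℝ} {ν : Measure ℝ}

lemma winProb_nonneg (r : ℝ) (ν : Measure ℝ) (b : ℝ) : 0 ≤ winProb r ν b := by
  unfold winProb; split_ifs <;> positivity

lemma winProb_of_lt (h : r < b) : winProb r ν b = 0 := by simp [winProb, not_le.2 h]

lemma Ioi_le_winProb (h : b ≤ r) : ν.real (Ioi b) ≤ winProb r ν b := by
  rw [winProb, if_pos h]
  have : 0 ≤ ν.real {b} := measureReal_nonneg
  linarith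

variable [IsProbabilityMeasure ν]

lemma winProb_add (h : b ≤ r) : winProb r ν b + ν.real {b} / 2 = ν.real (Ici b) := by
  have : ν.real (Ici b) = ν.real (Ioi b) + ν.real {b} := by
    rw [← Ioi_union_left, measureReal_union (by simp) (measurableSet_singleton b)]
  rw [winProb, if_pos h, this]; ring

lemma winProb_le_Ici (r : ℝ) (ν : Measure ℝ) [IsProbabilityMeasure ν] (b : ℝ) :
    winProb r ν b ≤ ν.real (Ici b) := by
  by_cases h : b ≤ r
  · have := winProb_add (ν := ν) h
    have : 0 ≤ ν.real {b} := measureReal_nonneg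
    linarith
  · rw [winProb_of_lt (not_le.1 h)]; exact measureReal_nonneg

lemma winProb_le_one (r : ℝ) (ν : Measure ℝ) [IsProbabilityMeasure ν] (b : ℝ) :
    winProb r ν b ≤ 1 := (winProb_le_Ici r ν b).trans measureReal_le_one

lemma Ici_le_winProb (h : b < b') (hr : b ≤ r) : ν.real (Ici b') ≤ winProb r ν b :=
  (measureReal_mono (Ici_subset_Ioi.2 h)).trans (Ioi_le_winProb hr)

lemma winProb_antitone (r : ℝ) (ν : Measure ℝ) [IsProbabilityMeasure ν] :
    Antitone (winProb r ν) := by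
  intro b b' h
  rcases h.eq_or_lt with rfl | h
  · rfl
  by_cases hr : b' ≤ r
  · exact (winProb_le_Ici r ν b').trans (Ici_le_winProb h (h.le.trans hr))
  · rw [winProb_of_lt (not_le.1 hr)]; exact winProb_nonneg _ _ _

/-- Interim payoff of a bidder of value `v` from the bid `b` against one rival with bid law `ν`. -/
noncomputable def duelPayoff (r : ℝ) (ν : Measure ℝ) (v b : ℝ) : ℝ := (b - v) * winProb r ν b

lemma duelPayoff_le (hr : 0 ≤ r) (hv : 0 ≤ v) (b : ℝ) : duelPayoff r ν v b ≤ r := by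
  unfold duelPayoff
  rcases le_or_gt b r with h | h
  · nlinarith [winProb_nonneg r ν b, winProb_le_one r ν b]
  · simp [winProb_of_lt h, hr]

lemma le_bestPayoff (hr : 0 ≤ r) (hv : 0 ≤ v) (hb : 0 ≤ b) :
    duelPayoff r ν v b ≤ bestPayoff (duelPayoff r ν v) :=
  le_csSup ⟨r, by rintro _ ⟨b, -, rfl⟩; exact duelPayoff_le hr hv b⟩ ⟨b, hb, rfl⟩

lemma bestPayoff_le {U : ℝ → ℝ} {c : ℝ} (h : ∀ b, 0 ≤ b → U b ≤ c) : bestPayoff U ≤ c :=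
  csSup_le (nonempty_Ici.image _) (by rintro _ ⟨b, hb, rfl⟩; exact h b hb)

lemma IsBestBid.bestPayoff_eq {U : ℝ → ℝ} (h : IsBestBid U b) : bestPayoff U = U b :=
  le_antisymm (bestPayoff_le h.2)
    (le_csSup ⟨U b, by rintro _ ⟨c, hc, rfl⟩; exact h.2 c hc⟩ ⟨b, h.1, rfl⟩)

lemma bestPayoff_nonneg (hr : 0 ≤ r) (hv : 0 ≤ v) : 0 ≤ bestPayoff (duelPayoff r ν v) := by
  have := le_bestPayoff (ν := ν) hr hv (b := r + 1) (by linarith)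
  rwa [duelPayoff, winProb_of_lt (by linarith), mul_zero] at this

lemma bestPayoff_antitone (hr : 0 ≤ r) (hv : 0 ≤ v) (h : v ≤ w) :
    bestPayoff (duelPayoff r ν w) ≤ bestPayoff (duelPayoff r ν v) :=
  bestPayoff_le fun b hb => le_trans
    (mul_le_mul_of_nonneg_right (by linarith) (winProb_nonneg r ν b)) (le_bestPayoff hr hv hb)

/-- Winning probabilities are at most one, so no bid loses more than `w - v` when the value rises
from `v` to `w`. -/
lemma bestPayoff_le_add (hr : 0 ≤ r) (hv : 0 ≤ v) (h : v ≤ w) :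
    bestPayoff (duelPayoff r ν v) ≤ bestPayoff (duelPayoff r ν w) + (w - v) :=
  bestPayoff_le fun b hb => by
    have h1 := le_bestPayoff (ν := ν) hr (hv.trans h) hb
    have h2 := winProb_le_one r ν b
    unfold duelPayoff at h1 ⊢
    nlinarith

/-- The envelope inequality. -/
lemma IsBestBid.bestPayoff_sub_le (h : IsBestBid (duelPayoff r ν w) b) (hr : 0 ≤ r) (hv : 0 ≤ v) :
    bestPayoff (duelPayoff r ν w) + (w - v) * winProb r ν b ≤ bestPayoff (duelPayoff r ν v) := by
  rw [h.bestPayoff_eq]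
  refine le_trans (le_of_eq ?_) (le_bestPayoff hr hv h.1)
  unfold duelPayoff; ring

/-- Undercutting: there is no rival mass at an optimal bid above one's value. -/
lemma IsBestBid.measureReal_singleton_eq_zero (h : IsBestBid (duelPayoff r ν v) b) (hv : 0 ≤ v)
    (hvb : v < b) (hb : b ≤ r) : ν.real {b} = 0 := by
  have key : ∀ t ∈ Ioo v b, (t - v) * ν.real (Ici b) ≤ (b - v) * winProb r ν b := fun t ht =>
    le_trans (mul_le_mul_of_nonneg_left (Ici_le_winProb ht.2 (ht.2.le.trans hb))
      (by linarith [ht.1])) (h.2 t (hv.trans ht.1.le))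
  -- Undercutting `b` by an arbitrarily small amount turns every tie into a win, so half of the atom
  -- at `b` would be a free gain.
  have lim : Filter.Tendsto (fun t => (t - v) * ν.real (Ici b)) (nhdsWithin b (Iio b))
      (nhds ((b - v) * ν.real (Ici b))) := by
    apply Filter.Tendsto.mono_left _ nhdsWithin_le_nhds
    exact Continuous.tendsto (by fun_prop) b
  have := le_of_tendsto lim (Filter.mem_of_superset (Ioo_mem_nhdsLT hvb) key)
  rw [← winProb_add hb] at this
  have h0 : 0 ≤ ν.real {b} := measureReal_nonneg
  have h1 : ν.real {b} ≤ 0 := by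
    by_contra hc
    nlinarith [mul_pos (sub_pos.2 hvb) (not_le.1 hc)]
  linarith

/-- Optimal bids that win with positive probability are nondecreasing in the value. -/
lemma IsBestBid.le_of_lt (h : IsBestBid (duelPayoff r ν v) b) (h' : IsBestBid (duelPayoff r ν w) b')
    (hvw : v < w) (hpos : 0 < winProb r ν b) : b ≤ b' := by
  by_contra! hlt
  have h1 := h.2 b' h'.1
  have h2 := h'.2 b h.1
  have h3 := winProb_antitone r ν hlt.le
  unfold duelPayoff at h1 h2
  -- The sum of the two optimality conditions. The lower bid `b'` wins at least as often, so both
  -- win equally often, and then type `w` prefers the higher bid `b`.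
  have h4 : (w - v) * (winProb r ν b' - winProb r ν b) ≤ 0 := by linarith
  have h5 : winProb r ν b' = winProb r ν b := by
    by_contra hne
    have : 0 < winProb r ν b' - winProb r ν b := by
      rcases h3.lt_or_eq with h | h
      · linarith
      · exact absurd h.symm hne
    nlinarith [mul_pos (sub_pos.2 hvw) this]
  rw [h5] at h2
  nlinarith

/-- By inner regularity it is enough to treat compact subsets, and each nonempty one lies below its
own greatest element `m`, where `Iic m` is null. Used to show that almost no bid drawn from `ν`
beats an independent draw from `ν` for sure. -/
lemma measure_setOf_Iic_eq_zero (ν : Measure ℝ) [IsFiniteMeasure ν] :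
    ν {t | ν (Iic t) = 0} = 0 := by
  set L := {t | ν (Iic t) = 0}
  have hL : IsLowerSet L := fun a b hba ha =>
    measure_mono_null (Iic_subset_Iic.2 hba) ha
  have hm : MeasurableSet L := hL.ordConnected.measurableSet
  by_contra h
  obtain ⟨K, hKL, hK, hpos⟩ := hm.exists_lt_isCompact (pos_iff_ne_zero.2 h)
  have hne : K.Nonempty := nonempty_of_measure_ne_zero hpos.ne'
  obtain ⟨m, hm, hmax⟩ := hK.exists_isGreatest hne
  exact hpos.ne' (measure_mono_null (fun x hx => hmax hx) (hKL hm))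

end WinProb

/-- The uniform distribution on `[v, 1]`. -/
noncomputable def unif (v : ℝ) : Measure ℝ :=
  (ENNReal.ofReal (1 - v))⁻¹ • volume.restrict (Icc v 1)

lemma unif_zero : unif 0 = volume.restrict (Icc 0 1) := by simp [unif]

lemma isProbabilityMeasure_unif {v : ℝ} (hv : v < 1) : IsProbabilityMeasure (unif v) := by
  refine ⟨?_⟩
  have : ENNReal.ofReal (1 - v) ≠ 0 := by simpa using hv
  simp [unif, ENNReal.inv_mul_cancel this ENNReal.ofReal_ne_top]

instance : IsProbabilityMeasure (unif 0) := isProbabilityMeasure_unif one_pos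

instance (v : ℝ) : NullSingletonClass (unif v) := ⟨fun x => by simp [unif]⟩

lemma ae_unif_mem (v : ℝ) : ∀ᵐ x ∂(unif v), x ∈ Icc v 1 :=
  (Measure.smul_absolutelyContinuous).ae_le (ae_restrict_mem measurableSet_Icc)

lemma unif_real_Ici {v y : ℝ} (hv : v < 1) (h : v ≤ y) (hy : y ≤ 1) :
    (unif v).real (Ici y) = (1 - y) / (1 - v) := by
  have : Ici y ∩ Icc v 1 = Icc y 1 := by
    ext x; simp only [mem_inter_iff, mem_Ici, mem_Icc]; grind
  rw [Measure.real, unif, Measure.smul_apply, Measure.restrict_apply measurableSet_Ici, this,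
    Real.volume_Icc, smul_eq_mul, ENNReal.toReal_mul, ENNReal.toReal_inv,
    ENNReal.toReal_ofReal (by linarith), ENNReal.toReal_ofReal (by linarith)]
  ring

lemma unif_real_Ioi {v y : ℝ} (hv : v < 1) (h : v ≤ y) (hy : y ≤ 1) :
    (unif v).real (Ioi y) = (1 - y) / (1 - v) := by
  rw [← unif_real_Ici hv h hy, measureReal_congr Ioi_ae_eq_Ici]

lemma unif_zero_real_Iio {v : ℝ} (h : 0 ≤ v) (hv : v ≤ 1) : (unif 0).real (Iio v) = v := by
  have h1 := probReal_compl_eq_one_sub (μ := unif 0) (measurableSet_Iio (a := v))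
  rw [compl_Iio, unif_real_Ici one_pos h hv] at h1
  linarith

/-! ### Acceptance decisions: every equilibrium has a cutoff -/

namespace Assessment

lemma rejectValue_two (s : Assessment) (F : Measure ℝ) (r v : ℝ)
    [IsProbabilityMeasure (s.specBid 1)] [IsProbabilityMeasure s.belief]
    (hm : Measurable s.bidWithout) :
    s.rejectValue 2 F r v = s.acceptProb F * bestPayoff (duelPayoff r (s.specBid 1) v)
      + (1 - s.acceptProb F) * bestPayoff (duelPayoff r (s.belief.map s.bidWithout) v) := by
  have h1 : sellerPayoffWith r s.belief (s.specBid 1) 0 (s.bidWith 1) v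
      = duelPayoff r (s.specBid 1) v := funext (sellerPayoffWith_zero _ _ _ _ _)
  have h2 : sellerPayoffWithout r s.belief 1 s.bidWithout v
      = duelPayoff r (s.belief.map s.bidWithout) v := funext (sellerPayoffWithout_one _ _ hm _)
  simp [rejectValue, h1, h2]

variable {s : Assessment} {r p : ℝ}

namespace IsSymmetricPBE

lemma isProbabilityMeasure_map (h : s.IsSymmetricPBE 2 (unif 0) r p) :
    IsProbabilityMeasure (s.belief.map s.bidWithout) :=
  have := h.prob_belief
  Measure.isProbabilityMeasure_map h.measurable_bidWithout.aemeasurable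

lemma isProbabilityMeasure_map_bidWith (h : s.IsSymmetricPBE 2 (unif 0) r p) :
    IsProbabilityMeasure (s.belief.map (s.bidWith 1)) :=
  have := h.prob_belief
  Measure.isProbabilityMeasure_map (h.measurable_bidWith 1).aemeasurable

lemma rejectValue_eq (h : s.IsSymmetricPBE 2 (unif 0) r p) (v : ℝ) :
    s.rejectValue 2 (unif 0) r v =
      s.acceptProb (unif 0) * bestPayoff (duelPayoff r (s.specBid 1) v)
      + (1 - s.acceptProb (unif 0)) *
        bestPayoff (duelPayoff r (s.belief.map s.bidWithout) v) :=
  have := h.prob_belief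
  have := h.prob_specBid 1
  rejectValue_two s _ r v h.measurable_bidWithout

lemma isBestBid_with (h : s.IsSymmetricPBE 2 (unif 0) r p) {x : ℝ} (hx : x ∈ Icc (0 : ℝ) 1)
    (ha : s.accept x < 1) : IsBestBid (duelPayoff r (s.specBid 1) x) (s.bidWith 1 x) := by
  have := h.prob_belief
  have := h.prob_specBid 1
  have h1 := h.bidWith_optimal 0 (by norm_num) x hx ha
  rwa [show sellerPayoffWith r s.belief (s.specBid (0 + 1)) 0 (s.bidWith (0 + 1)) x
      = duelPayoff r (s.specBid 1) x from funext (sellerPayoffWith_zero _ _ _ _ _)] at h1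

lemma isBestBid_without (h : s.IsSymmetricPBE 2 (unif 0) r p) {x : ℝ} (hx : x ∈ Icc (0 : ℝ) 1)
    (ha : s.accept x < 1) :
    IsBestBid (duelPayoff r (s.belief.map s.bidWithout) x) (s.bidWithout x) := by
  have := h.prob_belief
  have h1 := h.bidWithout_optimal x hx ha
  rwa [show sellerPayoffWithout r s.belief (2 - 1) s.bidWithout x
      = duelPayoff r (s.belief.map s.bidWithout) x from
        funext (sellerPayoffWithout_one _ _ h.measurable_bidWithout _)] at h1

lemma ae_isBestBid_spec (h : s.IsSymmetricPBE 2 (unif 0) r p) :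
    ∀ᵐ b ∂(s.specBid 1), IsBestBid (duelPayoff r (s.belief.map (s.bidWith 1)) 0) b := by
  have := h.prob_belief
  have h1 := h.specBid_optimal 1 (by norm_num)
  rwa [show specPayoff r s.belief 1 (s.bidWith 1)
      = duelPayoff r (s.belief.map (s.bidWith 1)) 0 from funext fun b => by
        rw [specPayoff_one _ _ (h.measurable_bidWith 1), duelPayoff, sub_zero]] at h1

lemma acceptProb_mem (h : s.IsSymmetricPBE 2 (unif 0) r p) :
    s.acceptProb (unif 0) ∈ Icc (0 : ℝ) 1 := by
  have hm : ∀ᵐ x ∂(unif 0), s.accept x ∈ Icc (0 : ℝ) 1 :=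
    (ae_unif_mem 0).mono fun x hx => h.accept_mem x hx
  constructor
  · exact integral_nonneg_of_ae (hm.mono fun x hx => hx.1)
  · refine (integral_mono_of_nonneg (hm.mono fun x hx => hx.1) (integrable_const (1 : ℝ))
      (hm.mono fun x hx => hx.2)).trans (by simp)

lemma rejectValue_nonneg (h : s.IsSymmetricPBE 2 (unif 0) r p) (hr : 0 ≤ r) {v : ℝ} (hv : 0 ≤ v) :
    0 ≤ s.rejectValue 2 (unif 0) r v := by
  have := h.isProbabilityMeasure_map
  have := h.prob_specBid 1
  have ha := h.acceptProb_mem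
  rw [h.rejectValue_eq]
  exact add_nonneg (mul_nonneg ha.1 (bestPayoff_nonneg hr hv))
    (mul_nonneg (by linarith [ha.2]) (bestPayoff_nonneg hr hv))

lemma rejectValue_antitone (h : s.IsSymmetricPBE 2 (unif 0) r p) (hr : 0 ≤ r) {v w : ℝ}
    (hv : 0 ≤ v) (hvw : v ≤ w) :
    s.rejectValue 2 (unif 0) r w ≤ s.rejectValue 2 (unif 0) r v := by
  have := h.isProbabilityMeasure_map
  have := h.prob_specBid 1
  have ha := h.acceptProb_mem
  rw [h.rejectValue_eq, h.rejectValue_eq]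
  exact add_le_add (mul_le_mul_of_nonneg_left (bestPayoff_antitone hr hv hvw) ha.1)
    (mul_le_mul_of_nonneg_left (bestPayoff_antitone hr hv hvw) (by linarith [ha.2]))

lemma le_price_of_accept_pos (h : s.IsSymmetricPBE 2 (unif 0) r p) (hr : 0 ≤ r) {c : ℝ}
    (hc : c ∈ Icc (0 : ℝ) 1) (hac : 0 < s.accept c) : c ≤ p := by
  have := h.accept_optimal c hc hac
  linarith [h.rejectValue_nonneg hr hc.1]

/-- Types above `p` would lose by accepting, whereas rejecting never yields less than 0; since `p <
1` these types have positive mass. -/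
lemma acceptProb_lt_one (h : s.IsSymmetricPBE 2 (unif 0) r p) (hr : 0 ≤ r) (hp : 0 ≤ p)
    (hp1 : p < 1) : s.acceptProb (unif 0) < 1 := by
  by_contra! hle
  have h1 := h.bayes
  rw [ENNReal.ofReal_of_nonpos (by linarith), zero_smul, withDensity_eq_zero_iff
    (by have := h.measurable_accept; fun_prop)] at h1
  have h2 : (unif 0) (Ioi p) = 0 := by
    rw [measure_eq_zero_iff_ae_notMem]
    filter_upwards [h1, ae_unif_mem 0] with x hx hx1 hpx
    have hx2 : 1 - s.accept x ≤ 0 := by simpa using hx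
    exact absurd (h.le_price_of_accept_pos hr hx1 (by linarith)) (not_le.2 hpx)
  have h3 := unif_real_Ioi one_pos hp hp1.le
  simp only [Measure.real, h2, ENNReal.toReal_zero] at h3
  linarith

/-- If some type accepts, then almost every lower type accepts for sure: otherwise the lower types
that reject would undercut each other with certainty. -/
lemma ae_accept_eq_one (h : s.IsSymmetricPBE 2 (unif 0) r p) (hr : 0 ≤ r) (hp : 0 ≤ p)
    (hp1 : p < 1) {c : ℝ} (hc : c ∈ Icc (0 : ℝ) 1) (hac : 0 < s.accept c) :
    ∀ᵐ x ∂(unif 0), x < c → s.accept x = 1 := by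
  have := h.prob_belief
  have := h.isProbabilityMeasure_map
  have := h.prob_specBid 1
  set ν := s.belief.map s.bidWithout with hν
  have hL : MeasurableSet {t | ν (Iic t) = 0} := by
    have : IsLowerSet {t | ν (Iic t) = 0} := fun a b hba ha =>
      measure_mono_null (Iic_subset_Iic.2 hba) ha
    exact this.ordConnected.measurableSet
  have hnull : s.belief (s.bidWithout ⁻¹' {t | ν (Iic t) = 0}) = 0 := by
    rw [← Measure.map_apply h.measurable_bidWithout hL]
    exact measure_setOf_Iic_eq_zero ν
  -- Through Bayes' rule, almost no type that may reject bids where the rival bid law has no mass at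
  -- or below the bid.
  have h0 : (unif 0).withDensity (fun x => ENNReal.ofReal (1 - s.accept x))
      (s.bidWithout ⁻¹' {t | ν (Iic t) = 0}) = 0 := by
    rw [h.bayes, Measure.smul_apply, hnull, smul_zero]
  rw [withDensity_apply_eq_zero (by have := h.measurable_accept; fun_prop)] at h0
  rw [measure_eq_zero_iff_ae_notMem] at h0
  filter_upwards [h0, ae_unif_mem 0] with x hx hx1 hxc
  by_contra hne
  have hlt : s.accept x < 1 := lt_of_le_of_ne (h.accept_mem x hx1).2 hne
  refine hx ⟨by simpa using hlt, ?_⟩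
  have ha := h.acceptProb_mem
  have ha1 := h.acceptProb_lt_one hr hp hp1
  set a := s.acceptProb (unif 0)
  have e1 : bestPayoff (duelPayoff r (s.specBid 1) x) - (c - x)
      ≤ bestPayoff (duelPayoff r (s.specBid 1) c) := by
    linarith [bestPayoff_le_add (ν := s.specBid 1) hr hx1.1 hxc.le]
  have e2 := (h.isBestBid_without hx1 hlt).bestPayoff_sub_le hr hc.1
  have e3 := h.accept_optimal c hc hac
  have e4 := h.reject_optimal x hx1 hlt
  rw [h.rejectValue_eq] at e3 e4
  -- Since `x` may reject and `c` may accept, the reject value drops by at least `c - x` between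
  -- them. The rent with the speculator accounts for at most `a * (c - x)`, and the envelope
  -- inequality bounds the other part.
  have e5 : (1 - a) * (c - x) * (1 - winProb r ν (s.bidWithout x)) ≤ 0 := by
    have f1 := mul_le_mul_of_nonneg_left e1 ha.1
    have f2 := mul_le_mul_of_nonneg_left e2 (by linarith : 0 ≤ 1 - a)
    rw [← hν] at e3 e4
    linarith
  have e6 : 1 ≤ winProb r ν (s.bidWithout x) := by
    by_contra! hw
    have := mul_pos (mul_pos (by linarith : 0 < 1 - a) (sub_pos.2 hxc)) (sub_pos.2 hw)
    linarith
  have hbr : s.bidWithout x ≤ r := by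
    by_contra! hb
    rw [winProb_of_lt hb] at e6
    linarith
  have e7 := winProb_add (ν := ν) hbr
  have e8 : ν.real (Ici (s.bidWithout x)) ≤ 1 := measureReal_le_one
  have e9 : ν.real {s.bidWithout x} = 0 := by
    linarith [measureReal_nonneg (μ := ν) (s := {s.bidWithout x})]
  rw [winProb, if_pos hbr, e9] at e6
  have e10 := probReal_compl_eq_one_sub (μ := ν) (measurableSet_Ioi (a := s.bidWithout x))
  rw [compl_Ioi] at e10
  have e11 : ν.real (Iic (s.bidWithout x)) = 0 :=
    le_antisymm (by linarith) measureReal_nonneg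
  exact (measureReal_eq_zero_iff).1 e11

lemma exists_hasCutoff (h : s.IsSymmetricPBE 2 (unif 0) r p) (hr : 0 ≤ r) (hp : 0 ≤ p)
    (hp1 : p < 1) : ∃ v ∈ Icc 0 p, s.HasCutoff (unif 0) v := by
  -- The cutoff is the supremum of the types that may accept; 0 is inserted to cover the case where
  -- there are none.
  set S : Set ℝ := insert 0 {c | c ∈ Icc (0 : ℝ) 1 ∧ 0 < s.accept c} with hS
  have hbdd : p ∈ upperBounds S := by
    rintro c (rfl | hc)
    · exact hp
    · exact h.le_price_of_accept_pos hr hc.1 hc.2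
  have hlub := isLUB_csSup (s := S) ⟨0, mem_insert _ _⟩ ⟨p, hbdd⟩
  set v := sSup S
  refine ⟨v, ⟨hlub.1 (mem_insert _ _), hlub.2 hbdd⟩, ?_⟩
  obtain ⟨u, -, hu, huS⟩ := hlub.exists_seq_monotone_tendsto ⟨0, mem_insert _ _⟩
  have h1 : ∀ᵐ x ∂(unif 0), ∀ n, x < u n → s.accept x = 1 := by
    rw [ae_all_iff]
    intro n
    rcases huS.2 n with h0 | hc
    · filter_upwards [ae_unif_mem 0] with x hx hlt
      rw [h0] at hlt; exact absurd hx.1 (not_le.2 hlt)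
    · exact h.ae_accept_eq_one hr hp hp1 hc.1 hc.2
  have h2 : ∀ᵐ x ∂(unif 0), x ≠ v := by
    rw [ae_iff]; simp
  filter_upwards [h1, h2, ae_unif_mem 0] with x hx hxv hx1
  split_ifs with hlt
  · obtain ⟨n, hn⟩ := (huS.1.eventually (lt_mem_nhds hlt)).exists
    exact hx n hn
  · by_contra hne
    have : 0 < s.accept x := lt_of_le_of_ne (h.accept_mem x hx1).1 (Ne.symm hne)
    exact hlt (lt_of_le_of_ne (hlub.1 (mem_insert_of_mem _ ⟨hx1, this⟩)) hxv)

end IsSymmetricPBE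

end Assessment

/-! ### Profit bounds valid in every equilibrium with a given cutoff -/

namespace Assessment

variable {s : Assessment} {r p v : ℝ}

lemma HasCutoff.acceptProb_eq (hc : s.HasCutoff (unif 0) v) (hv : v ∈ Icc (0 : ℝ) 1) :
    s.acceptProb (unif 0) = v := by
  have h1 : s.acceptProb (unif 0) = ∫ x, (Iio v).indicator 1 x ∂(unif 0) :=
    integral_congr_ae (hc.mono fun x hx => by simp [hx, indicator_apply])
  rw [h1, integral_indicator_one measurableSet_Iio, unif_zero_real_Iio hv.1 hv.2]

lemma HasCutoff.withDensity_eq (hc : s.HasCutoff (unif 0) v) (hv : v ∈ Ico (0 : ℝ) 1) :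
    (unif 0).withDensity (fun x => ENNReal.ofReal (1 - s.accept x)) =
      ENNReal.ofReal (1 - v) • unif v := by
  have h1 : (fun x => ENNReal.ofReal (1 - s.accept x)) =ᵐ[unif 0] (Ici v).indicator 1 :=
    hc.mono fun x hx => by
      by_cases hxv : x < v
      · simp [hx, hxv, not_le.2 hxv]
      · simp [hx, hxv, not_lt.1 hxv]
  have hne : ENNReal.ofReal (1 - v) ≠ 0 := by simpa using hv.2
  have h2 : Ici v ∩ Icc 0 1 = Icc v 1 := by
    ext x; have := hv.1; simp only [mem_inter_iff, mem_Ici, mem_Icc]; grind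
  rw [withDensity_congr_ae h1, withDensity_indicator_one measurableSet_Ici, unif_zero,
    Measure.restrict_restrict measurableSet_Ici, h2, unif, smul_smul,
    ENNReal.mul_inv_cancel hne ENNReal.ofReal_ne_top, one_smul]

namespace IsSymmetricPBE

lemma belief_eq (h : s.IsSymmetricPBE 2 (unif 0) r p) (hc : s.HasCutoff (unif 0) v)
    (hv : v ∈ Ico (0 : ℝ) 1) : s.belief = unif v := by
  have h1 := h.bayes
  rw [hc.withDensity_eq hv, hc.acceptProb_eq ⟨hv.1, hv.2.le⟩] at h1
  have hne : ENNReal.ofReal (1 - v) ≠ 0 := by simpa using hv.2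
  have h2 := congrArg (fun μ => (ENNReal.ofReal (1 - v))⁻¹ • μ) h1
  simp only [smul_smul] at h2
  rw [ENNReal.inv_mul_cancel hne ENNReal.ofReal_ne_top, one_smul, one_smul] at h2
  exact h2.symm

/-- Almost every bid in the speculator's mixture is optimal, so against one seller his expected
payoff is the best payoff. -/
lemma specProfit_eq (h : s.IsSymmetricPBE 2 (unif 0) r p) (hc : s.HasCutoff (unif 0) v)
    (hv : v ∈ Icc (0 : ℝ) 1) :
    s.specProfit 2 (unif 0) r p = v ^ 2 * (∫ b, (if b ≤ r then b else 0) ∂(s.specBid 0))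
      + 2 * (1 - v) * v * bestPayoff (duelPayoff r (s.belief.map (s.bidWith 1)) 0)
      - 2 * v * p := by
  have := h.prob_belief
  have := h.prob_specBid 1
  have h1 : ∫ b, specPayoff r s.belief 1 (s.bidWith 1) b ∂(s.specBid 1)
      = bestPayoff (duelPayoff r (s.belief.map (s.bidWith 1)) 0) := by
    rw [integral_congr_ae (g := fun _ =>
      bestPayoff (duelPayoff r (s.belief.map (s.bidWith 1)) 0))]
    · simp
    · filter_upwards [h.ae_isBestBid_spec] with b hb
      rw [hb.bestPayoff_eq, specPayoff_one _ _ (h.measurable_bidWith 1), duelPayoff, sub_zero]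
  have h0 : ∫ b, specPayoff r s.belief 0 (s.bidWith 0) b ∂(s.specBid 0)
      = ∫ b, (if b ≤ r then b else 0) ∂(s.specBid 0) := by
    simp only [specPayoff_zero]
  rw [specProfit, hc.acceptProb_eq hv, Finset.sum_range_succ, Finset.sum_range_one, h1, h0]
  norm_num

/-- Removes the exceptional null set above the cutoff, so that bid optimality is available at any
chosen single type: if `x` might accept, almost all of `[v, x)` would accept. -/
lemma accept_eq_zero (h : s.IsSymmetricPBE 2 (unif 0) r p) (hr : 0 ≤ r) (hp : 0 ≤ p)
    (hp1 : p < 1) (hc : s.HasCutoff (unif 0) v) (hv : 0 ≤ v) {x : ℝ} (hx : x ∈ Icc (0 : ℝ) 1)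
    (hvx : v < x) : s.accept x = 0 := by
  by_contra hne
  have hpos : 0 < s.accept x := lt_of_le_of_ne (h.accept_mem x hx).1 (Ne.symm hne)
  have h1 : (unif 0) (Ico v x) = 0 := by
    rw [measure_eq_zero_iff_ae_notMem]
    filter_upwards [hc, h.ae_accept_eq_one hr hp hp1 hx hpos] with y hy hy1 hmem
    rw [hy1 hmem.2, if_neg (not_lt.2 hmem.1)] at hy
    exact one_ne_zero hy
  have h2 : (unif 0).real (Iio x) ≤ (unif 0).real (Iio v) + (unif 0).real (Ico v x) := by
    rw [← Iio_union_Ico_eq_Iio hvx.le]; exact measureReal_union_le _ _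
  rw [unif_zero_real_Iio hx.1 hx.2, unif_zero_real_Iio hv (hvx.le.trans hx.2), Measure.real, h1,
    ENNReal.toReal_zero] at h2
  linarith

/-- Accepting types exist arbitrarily close below `v`, and their reject value is at least that of
`v`. -/
lemma cutoff_add_rejectValue_le (h : s.IsSymmetricPBE 2 (unif 0) r p) (hr : 0 ≤ r)
    (hc : s.HasCutoff (unif 0) v) (hv : v ∈ Ioc (0 : ℝ) 1) :
    v + s.rejectValue 2 (unif 0) r v ≤ p := by
  refine le_of_forall_lt fun c hlt => ?_
  have hex : ∃ x ∈ Icc (0 : ℝ) 1, c - s.rejectValue 2 (unif 0) r v < x ∧ x < v ∧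
      s.accept x = 1 := by
    by_contra! hno
    set d := max 0 (c - s.rejectValue 2 (unif 0) r v) with hd
    have hdv : d < v := max_lt hv.1 (by linarith)
    have h1 : (unif 0) (Ioo d v) = 0 := by
      rw [measure_eq_zero_iff_ae_notMem]
      filter_upwards [hc, ae_unif_mem 0] with y hy hy1 hmem
      exact hno y hy1 ((le_max_right _ _).trans_lt hmem.1) hmem.2 (by rw [hy, if_pos hmem.2])
    have h2 : (unif 0).real (Iio v) ≤ (unif 0).real (Iic d) + (unif 0).real (Ioo d v) := by
      rw [← Iic_union_Ioo_eq_Iio hdv]; exact measureReal_union_le _ _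
    rw [measureReal_congr Iio_ae_eq_Iic.symm, unif_zero_real_Iio hv.1.le hv.2,
      unif_zero_real_Iio (le_max_left _ _) (hdv.le.trans hv.2), Measure.real, h1,
      ENNReal.toReal_zero] at h2
    linarith
  obtain ⟨x, hx, hcx, hxv, hax⟩ := hex
  have h1 := h.accept_optimal x hx (by rw [hax]; exact one_pos)
  have h2 := h.rejectValue_antitone hr hx.1 hxv.le
  linarith

/-- A seller with value `v` can undercut every bid of the speculator. -/
lemma spec_best_sub_le (h : s.IsSymmetricPBE 2 (unif 0) r p) (hr : 0 ≤ r) (hv : 0 ≤ v) :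
    bestPayoff (duelPayoff r (s.belief.map (s.bidWith 1)) 0) - v ≤
      bestPayoff (duelPayoff r (s.specBid 1) v) := by
  have := h.isProbabilityMeasure_map_bidWith
  have := h.prob_specBid 1
  set u := bestPayoff (duelPayoff r (s.belief.map (s.bidWith 1)) 0) with hu
  have hur : u ≤ r := bestPayoff_le fun b _ => duelPayoff_le hr le_rfl b
  -- A bid earns at most itself, so no optimal bid lies below the optimal payoff `u`; a seller
  -- bidding just below `u` wins for sure.
  have hσ : ∀ᵐ b ∂(s.specBid 1), b ∈ Ici u := by
    filter_upwards [h.ae_isBestBid_spec] with b hb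
    rw [mem_Ici, hu, hb.bestPayoff_eq, duelPayoff, sub_zero]
    exact mul_le_of_le_one_right hb.1 (winProb_le_one _ _ _)
  have hone : (s.specBid 1).real (Ici u) = 1 := by
    rw [Measure.real, (mem_ae_iff_prob_eq_one measurableSet_Ici).1 hσ]; simp
  rcases le_or_gt u 0 with h0 | h0
  · linarith [bestPayoff_nonneg (ν := s.specBid 1) hr hv]
  refine le_of_forall_lt fun c hcu => ?_
  set b := max 0 ((c + v + u) / 2) with hb
  have hbu : b < u := max_lt h0 (by linarith)
  have h1 := Ici_le_winProb (ν := s.specBid 1) hbu (hbu.le.trans hur)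
  rw [hone] at h1
  have h2 := le_bestPayoff (ν := s.specBid 1) hr hv (le_max_left 0 ((c + v + u) / 2))
  have h3 : winProb r (s.specBid 1) b = 1 := le_antisymm (winProb_le_one _ _ _) h1
  rw [duelPayoff, ← hb, h3] at h2
  have : (c + v + u) / 2 ≤ b := le_max_right _ _
  linarith

/-- The speculator's auction payoff is at most what he obtains by bidding the reserve price against
sellers who bid their values. -/
lemma spec_best_le (h : s.IsSymmetricPBE 2 (unif 0) r p) (hr2 : r ≤ 1 / 2)
    (hc : s.HasCutoff (unif 0) v) (hv : v ∈ Icc 0 r) :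
    bestPayoff (duelPayoff r (s.belief.map (s.bidWith 1)) 0) ≤ r * (1 - r) / (1 - v) := by
  have := h.isProbabilityMeasure_map_bidWith
  have := h.prob_specBid 1
  have hv1 : v < 1 := by linarith [hv.2]
  have hbel := h.belief_eq hc ⟨hv.1, hv1⟩
  set σ := s.specBid 1 with hσ
  set ν := s.belief.map (s.bidWith 1) with hν
  set u := bestPayoff (duelPayoff r ν 0) with hu
  have hk : v ≤ r * (1 - r) / (1 - v) := by
    rw [le_div_iff₀ (by linarith)]; nlinarith [hv.1, hv.2]
  rcases le_or_gt u 0 with h0 | h0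
  · linarith [hv.1]
  have hσu : ∀ᵐ b ∂σ, b ∈ Ici u ∧ b ≤ r ∧ u = b * winProb r ν b := by
    filter_upwards [h.ae_isBestBid_spec] with b hb
    have h1 : u = b * winProb r ν b := by rw [hu, hb.bestPayoff_eq, duelPayoff, sub_zero]
    refine ⟨?_, ?_, h1⟩
    · rw [mem_Ici, h1]
      exact mul_le_of_le_one_right hb.1 (winProb_le_one _ _ _)
    · by_contra! hlt
      rw [winProb_of_lt hlt, mul_zero] at h1
      linarith
  -- the top of the support of the speculator's bid
  set T := {t : ℝ | σ (Ioi t) = 0} with hT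
  have hrT : r ∈ T := by
    rw [hT, mem_ofPred_eq, measure_eq_zero_iff_ae_notMem]
    filter_upwards [hσu] with b hb hmem
    exact absurd hb.2.1 (not_le.2 hmem)
  have hTb : u ∈ lowerBounds T := by
    intro t ht
    by_contra! htu
    rw [hT, mem_ofPred_eq, measure_eq_zero_iff_ae_notMem] at ht
    have : ∀ᵐ b ∂σ, False := by
      filter_upwards [ht, hσu] with b hb1 hb2
      exact hb1 (htu.trans_le hb2.1)
    simp only [Filter.eventually_false_iff_eq_bot, ae_eq_bot] at this
    exact IsProbabilityMeasure.ne_zero σ this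
  have hglb := isGLB_csInf ⟨r, hrT⟩ ⟨u, hTb⟩
  set B := sInf T with hB
  have hBr : B ≤ r := hglb.1 hrT
  have huB : u ≤ B := hglb.2 hTb
  have hpos : ∀ t < B, 0 < σ.real (Ioi t) := fun t ht => by
    have : σ (Ioi t) ≠ 0 := fun h0 => absurd (hglb.1 (show t ∈ T from h0)) (not_le.2 ht)
    exact ENNReal.toReal_pos this (measure_ne_top _ _)
  have hBT : σ (Ioi B) = 0 := by
    obtain ⟨w, -, -, hw, hwT⟩ := hglb.exists_seq_antitone_tendsto ⟨r, hrT⟩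
    have : Ioi B ⊆ ⋃ n, Ioi (w n) := fun x hx => by
      obtain ⟨n, hn⟩ := (hw.eventually (gt_mem_nhds hx)).exists
      exact mem_iUnion.2 ⟨n, hn⟩
    exact measure_mono_null this (measure_iUnion_null hwT)
  -- rejecting types below `B` bid less than `B`
  have hlow : ∀ x ∈ Icc (0 : ℝ) 1, s.accept x < 1 → x < B → s.bidWith 1 x < B := by
    intro x hx hax hxB
    have hbest := h.isBestBid_with hx hax
    have hm : x < (x + B) / 2 ∧ (x + B) / 2 < B := ⟨by linarith, by linarith⟩
    have h1 := hbest.2 ((x + B) / 2) (by linarith [hx.1])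
    have h2 : 0 < duelPayoff r σ x ((x + B) / 2) :=
      mul_pos (by linarith) ((hpos _ hm.2).trans_le (Ioi_le_winProb (by linarith)))
    have h3 : x ≤ s.bidWith 1 x := h.undominated_with 1 le_rfl (by norm_num) x hx
    set b := s.bidWith 1 x
    have h4 : 0 < (b - x) * winProb r σ b := h2.trans_le h1
    by_contra! hle
    have hbr : b ≤ r := by
      by_contra! hlt
      rw [winProb_of_lt hlt, mul_zero] at h4
      exact lt_irrefl _ h4
    have h5 := hbest.measureReal_singleton_eq_zero hx.1 (hxB.trans_le hle) hbr
    have h6 : σ.real (Ioi b) = 0 := by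
      rw [Measure.real, measure_mono_null (Ioi_subset_Ioi hle) hBT]; rfl
    rw [winProb, if_pos hbr, h5, h6] at h4
    norm_num at h4
  have hνB : ν.real (Ici B) ≤ (unif v).real (Ici B) := by
    rw [hν, map_measureReal_apply (h.measurable_bidWith 1) measurableSet_Ici, hbel]
    refine ENNReal.toReal_mono ?_ (measure_mono_ae ?_)
    · have := isProbabilityMeasure_unif hv1
      exact measure_ne_top _ _
    · have hacc : ∀ᵐ x ∂(unif v), s.accept x < 1 := by
        have h1 := hc.withDensity_eq ⟨hv.1, hv1⟩
        have h2 : unif v ≪ unif 0 := by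
          have : unif v ≪ ENNReal.ofReal (1 - v) • unif v :=
            Measure.absolutelyContinuous_smul (by simpa using hv1)
          rw [← h1] at this
          exact this.trans (withDensity_absolutelyContinuous _ _)
        filter_upwards [h2.ae_le hc, ae_unif_mem v] with x hx hx1
        rw [hx, if_neg (not_lt.2 hx1.1)]; exact one_pos
      filter_upwards [hacc, ae_unif_mem v] with x hx hx1 hmem
      by_contra! hlt
      exact absurd (hlow x ⟨hv.1.trans hx1.1, hx1.2⟩ hx (not_le.1 hlt)) (not_lt.2 hmem)
  -- bids of the speculator close to `B`
  have huν : u ≤ B * ν.real (Ici B) := by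
    have hstep : ∀ t < B, u ≤ B * ν.real (Ici t) := by
      intro t ht
      have : ∃ b, t < b ∧ b ≤ B ∧ u = b * winProb r ν b := by
        by_contra! hno
        refine (hpos t ht).ne' ?_
        rw [measureReal_eq_zero_iff, measure_eq_zero_iff_ae_notMem]
        filter_upwards [hσu, measure_eq_zero_iff_ae_notMem.1 hBT] with b hb hbB htb
        exact hno b htb (not_lt.1 hbB) hb.2.2
      obtain ⟨b, htb, hbB, hub⟩ := this
      have h1 : winProb r ν b ≤ ν.real (Ici t) :=
        (winProb_le_Ici r ν b).trans (measureReal_mono (Ici_subset_Ici.2 htb.le))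
      rw [hub]
      exact mul_le_mul hbB h1 (winProb_nonneg _ _ _) (by linarith)
    -- Continuity from above of `ν` along `Ici (w n)` passes to the limit; the speculator need not
    -- bid `B` itself with positive probability.
    obtain ⟨w, hw, hwB, hwt⟩ := exists_seq_strictMono_tendsto B
    have hI : Ici B = ⋂ n, Ici (w n) := by
      ext x
      simp only [mem_Ici, mem_iInter]
      exact ⟨fun hx n => (hwB n).le.trans hx, fun hx => le_of_tendsto' hwt hx⟩
    have hlim := tendsto_measure_iInter_atTop (μ := ν) (s := fun n => Ici (w n))
      (fun n => measurableSet_Ici.nullMeasurableSet)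
      (fun m n hmn => Ici_subset_Ici.2 (hw.monotone hmn)) ⟨0, measure_ne_top _ _⟩
    rw [← hI] at hlim
    have hlim2 := ((ENNReal.tendsto_toReal (measure_ne_top ν (Ici B))).comp hlim).const_mul B
    exact ge_of_tendsto' hlim2 fun n => hstep _ (hwB n)
  have hfin : u ≤ B * (unif v).real (Ici B) :=
    huν.trans (mul_le_mul_of_nonneg_left hνB (by linarith))
  rcases le_or_gt v B with hvB | hvB
  · rw [unif_real_Ici hv1 hvB (by linarith)] at hfin
    refine hfin.trans ?_
    rw [← mul_div_assoc]
    exact div_le_div_of_nonneg_right (by nlinarith) (by linarith)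
  · linarith

/-- A lower bound for the rent of the cutoff type when the speculator is absent. -/
lemma le_best_without (h : s.IsSymmetricPBE 2 (unif 0) r p) (hr : 0 ≤ r) (hr1 : r < 1)
    (hp : 0 ≤ p) (hp1 : p < 1) (hc : s.HasCutoff (unif 0) v) {c : ℝ} (hv : 0 ≤ v) (hvc : v < c)
    (hcr : c < r) :
    ((c - v) * (1 - c) + (r - c) * (1 - r)) / (1 - v) ≤
      bestPayoff (duelPayoff r (s.belief.map s.bidWithout) v) := by
  have := h.isProbabilityMeasure_map
  have hv1 : v < 1 := by linarith
  have := isProbabilityMeasure_unif hv1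
  have hbel := h.belief_eq hc ⟨hv, hv1⟩
  have hae : ∀ᵐ x ∂(unif v), x ∈ Icc 0 1 ∧ (v < x → s.accept x < 1) := by
    filter_upwards [ae_unif_mem v] with x hx
    have hx0 : x ∈ Icc (0 : ℝ) 1 := ⟨hv.trans hx.1, hx.2⟩
    exact ⟨hx0, fun hlt => by rw [h.accept_eq_zero hr hp hp1 hc hv hx0 hlt]; exact one_pos⟩
  have hcI : c ∈ Icc (0 : ℝ) 1 := ⟨by linarith, by linarith⟩
  have hac : s.accept c < 1 := by
    rw [h.accept_eq_zero hr hp hp1 hc hv hcI hvc]; exact one_pos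
  have hbest := h.isBestBid_without hcI hac
  set ν := s.belief.map s.bidWithout with hν
  set b := s.bidWithout c
  -- Nobody bids below his value, so the bid `r` beats every rival with value above `r`. The final
  -- bound is a lower Riemann sum of the integral of (1-x)/(1-v) over `[v, r]`, with the single
  -- interior node `c`.
  have h1 : (1 - r) / (1 - v) ≤ winProb r ν r := by
    rw [← unif_real_Ioi hv1 (by linarith) hr1.le]
    refine le_trans ?_ (Ioi_le_winProb le_rfl)
    rw [hν, map_measureReal_apply h.measurable_bidWithout measurableSet_Ioi, hbel]
    refine ENNReal.toReal_mono (measure_ne_top _ _) (measure_mono_ae ?_)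
    filter_upwards [hae] with x hx hmem
    exact lt_of_lt_of_le hmem (h.undominated_without x hx.1)
  have h2 : (r - c) * ((1 - r) / (1 - v)) ≤ bestPayoff (duelPayoff r ν c) :=
    le_trans (mul_le_mul_of_nonneg_left h1 (by linarith)) (le_bestPayoff hr hcI.1 hr)
  have h3 : 0 < (b - c) * winProb r ν b := by
    have := hbest.bestPayoff_eq
    rw [duelPayoff] at this
    rw [← this]
    exact lt_of_lt_of_le (mul_pos (by linarith) (div_pos (by linarith) (by linarith))) h2
  have hcb : c ≤ b := h.undominated_without c hcI
  have hW : 0 < winProb r ν b := pos_of_mul_pos_right h3 (by linarith)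
  have hcb' : c < b := by
    have := pos_of_mul_pos_left h3 hW.le
    linarith
  have hbr : b ≤ r := by
    by_contra! hlt
    rw [winProb_of_lt hlt] at hW
    exact lt_irrefl _ hW
  have h4 := hbest.measureReal_singleton_eq_zero hcI.1 hcb' hbr
  have h5 := winProb_add (ν := ν) hbr
  -- Higher types bid no lower than type `c`, and there is no atom at `b`, so type `c` beats all of
  -- them.
  have h6 : (1 - c) / (1 - v) ≤ ν.real (Ici b) := by
    rw [← unif_real_Ioi hv1 hvc.le hcI.2, hν,
      map_measureReal_apply h.measurable_bidWithout measurableSet_Ici, hbel]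
    refine ENNReal.toReal_mono (measure_ne_top _ _) (measure_mono_ae ?_)
    filter_upwards [hae] with x hx hmem
    exact hbest.le_of_lt (h.isBestBid_without hx.1 (hx.2 (hvc.trans hmem))) hmem hW
  have h7 := hbest.bestPayoff_sub_le hr hv
  have h8 : (1 - c) / (1 - v) ≤ winProb r ν b := by linarith
  have h9 := mul_le_mul_of_nonneg_left h8 (sub_pos.2 hvc).le
  calc _ = (r - c) * ((1 - r) / (1 - v)) + (c - v) * ((1 - c) / (1 - v)) := by ring
    _ ≤ _ := by linarith

lemma specProfit_eq_zero (h : s.IsSymmetricPBE 2 (unif 0) r p) (hc : s.HasCutoff (unif 0) 0) :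
    s.specProfit 2 (unif 0) r p = 0 := by
  rw [h.specProfit_eq hc ⟨le_rfl, zero_le_one⟩]; ring

lemma specProfit_neg (h : s.IsSymmetricPBE 2 (unif 0) (1 / 3) p) (hp : p ∈ Icc 0 (1 / 3))
    (hc : s.HasCutoff (unif 0) v) (hv : v ∈ Ioc 0 (1 / 3)) :
    s.specProfit 2 (unif 0) (1 / 3) p < 0 := by
  have := h.isProbabilityMeasure_map
  have := h.prob_specBid 0
  obtain ⟨hv0, hv3⟩ := hv
  have hv1 : v ∈ Icc (0 : ℝ) 1 := ⟨hv0.le, by linarith⟩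
  have h0 : ∫ b, (if b ≤ (1 / 3 : ℝ) then b else 0) ∂(s.specBid 0) ≤ 1 / 3 := by
    -- Only an upper bound is needed. In the nonintegrable case the integral has the default value
    -- 0.
    by_cases hi : Integrable (fun b : ℝ => if b ≤ (1 / 3 : ℝ) then b else 0) (s.specBid 0)
    · refine (integral_mono hi (integrable_const (1 / 3 : ℝ)) fun b => ?_).trans (by simp)
      dsimp only
      split_ifs with hb <;> linarith
    · rw [integral_undef hi]; norm_num
  have h1 := h.cutoff_add_rejectValue_le (by norm_num) hc ⟨hv0, hv1.2⟩
  rw [h.rejectValue_eq, hc.acceptProb_eq hv1] at h1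
  have h2 := h.spec_best_sub_le (by norm_num) hv0.le
  have h3 := h.spec_best_le (by norm_num) hc ⟨hv0.le, hv3⟩
  have h4 : (1 / 3 - v) * (3 - v) / 4 ≤
      (1 - v) * bestPayoff (duelPayoff (1 / 3) (s.belief.map s.bidWithout) v) := by
    rcases hv3.lt_or_eq with hlt | rfl
    -- The midpoint of `[v, 1/3]` as the only node is already precise enough.
    · have := h.le_best_without (c := (v + 1 / 3) / 2) (by norm_num) (by norm_num) hp.1
        (by linarith [hp.2]) hc hv0.le (by linarith) (by linarith)
      rw [div_le_iff₀ (by linarith)] at this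
      linarith
    · have := bestPayoff_nonneg (r := 1 / 3) (ν := s.belief.map s.bidWithout) (v := 1 / 3)
        (by norm_num) (by norm_num)
      linarith
  rw [h.specProfit_eq hc hv1]
  set u := bestPayoff (duelPayoff (1 / 3) (s.belief.map (s.bidWith 1)) 0)
  set U1 := bestPayoff (duelPayoff (1 / 3) (s.specBid 1) v)
  set U2 := bestPayoff (duelPayoff (1 / 3) (s.belief.map s.bidWithout) v)
  set I := ∫ b, (if b ≤ (1 / 3 : ℝ) then b else 0) ∂(s.specBid 0)
  have h5 : u * (1 - v) ≤ 2 / 9 := by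
    rw [le_div_iff₀ (by linarith)] at h3; linarith
  have h6 : v * (u - v) ≤ v * U1 := mul_le_mul_of_nonneg_left h2 hv0.le
  have h7 : v * I ≤ v * (1 / 3) := mul_le_mul_of_nonneg_left h0 hv0.le
  have h8 : v * I + 2 * (1 - v) * u - 2 * p ≤
      v / 3 + 2 * (1 - 2 * v) * u - 2 * v + 2 * v ^ 2 - (1 / 3 - v) * (3 - v) / 2 := by linarith
  -- The factor `1 - v` brings in `u * (1 - v) ≤ 2 / 9`, leaving a polynomial in `v`; the
  -- coefficient `1 - 2 * v` of `u` is positive as `v ≤ 1 / 3`.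
  have h9 : (1 - v) * (v / 3 + 2 * (1 - 2 * v) * u - 2 * v + 2 * v ^ 2
      - (1 / 3 - v) * (3 - v) / 2) < 0 := by
    have : (1 - 2 * v) * (u * (1 - v)) ≤ (1 - 2 * v) * (2 / 9) :=
      mul_le_mul_of_nonneg_left h5 (by linarith)
    nlinarith [mul_nonneg hv0.le (sub_nonneg.2 hv3), mul_nonneg (mul_nonneg hv0.le hv0.le)
      (sub_nonneg.2 hv3)]
  have h10 : v / 3 + 2 * (1 - 2 * v) * u - 2 * v + 2 * v ^ 2 - (1 / 3 - v) * (3 - v) / 2 < 0 := by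
    by_contra! hge
    nlinarith [mul_nonneg (by linarith : 0 ≤ 1 - v) hge]
  have h11 : v * (v * I + 2 * (1 - v) * u - 2 * p) < 0 := mul_neg_of_pos_of_neg hv0 (by linarith)
  linarith

end IsSymmetricPBE

end Assessment

/-! ### Winning probabilities against strictly increasing bids -/

lemma isBestBid_self {r x : ℝ} (ν : Measure ℝ) (hr : 0 ≤ r) (hx : r ≤ x) :
    IsBestBid (duelPayoff r ν x) x := by
  refine ⟨hr.trans hx, fun b _ => ?_⟩
  rw [show duelPayoff r ν x x = 0 by simp [duelPayoff]]
  rcases le_or_gt b r with h | h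
  · exact mul_nonpos_of_nonpos_of_nonneg (by linarith) (winProb_nonneg _ _ _)
  · simp [duelPayoff, winProb_of_lt h]

/-- Up to a null set of ties, the bid of type `y` beats exactly the rivals with values above `y`. -/
lemma winProb_map_unif {r v y : ℝ} {β : ℝ → ℝ} (hβ : Measurable β)
    (hmono : StrictMonoOn β (Icc 0 1)) (hv : 0 ≤ v) (hv1 : v < 1) (hy : y ∈ Icc v 1)
    (hr : β y ≤ r) : winProb r ((unif v).map β) (β y) = (1 - y) / (1 - v) := by
  have hmem : ∀ᵐ x ∂(unif v), x ∈ Icc (0 : ℝ) 1 :=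
    (ae_unif_mem v).mono fun x hx => ⟨hv.trans hx.1, hx.2⟩
  have hyI : y ∈ Icc (0 : ℝ) 1 := ⟨hv.trans hy.1, hy.2⟩
  have h1 : (β ⁻¹' Ioi (β y) : Set ℝ) =ᵐ[unif v] Ioi y :=
    Filter.eventuallyEq_set.2 (hmem.mono fun x hx => hmono.lt_iff_lt hyI hx)
  have h2 : (β ⁻¹' {β y} : Set ℝ) =ᵐ[unif v] ({y} : Set ℝ) :=
    Filter.eventuallyEq_set.2 (hmem.mono fun x hx => hmono.injOn.eq_iff hx hyI)
  rw [winProb, if_pos hr, map_measureReal_apply hβ measurableSet_Ioi,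
    map_measureReal_apply hβ (measurableSet_singleton _), measureReal_congr h1,
    measureReal_congr h2, unif_real_Ioi hv1 hy.1 hy.2]
  simp [Measure.real]

/-! ### Equilibrium bids for the uniform distribution and the reserve price `1 / 3` -/

/-- Equilibrium bid of a seller who competes with the speculator. -/
noncomputable def eqBidWith (x : ℝ) : ℝ := if x ≤ 1 / 3 then 2 / (9 * (1 - x)) else x

/-- Equilibrium bid of a seller who competes with another seller. -/
noncomputable def eqBidWithout (x : ℝ) : ℝ :=
  if x ≤ 1 / 3 then (5 / 9 - x ^ 2) / (2 * (1 - x)) else x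

lemma measurable_eqBidWith : Measurable eqBidWith :=
  Measurable.ite measurableSet_Iic (by fun_prop) measurable_id

lemma measurable_eqBidWithout : Measurable eqBidWithout :=
  Measurable.ite measurableSet_Iic (by fun_prop) measurable_id

lemma eqBidWith_of_le {x : ℝ} (h : x ≤ 1 / 3) : eqBidWith x = 2 / (9 * (1 - x)) := if_pos h

lemma eqBidWithout_of_le {x : ℝ} (h : x ≤ 1 / 3) :
    eqBidWithout x = (5 / 9 - x ^ 2) / (2 * (1 - x)) := if_pos h

lemma eqBidWith_of_ge {x : ℝ} (h : 1 / 3 ≤ x) : eqBidWith x = x := by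
  rcases h.eq_or_lt with rfl | h
  · norm_num [eqBidWith]
  · exact if_neg (not_le.2 h)

lemma eqBidWithout_of_ge {x : ℝ} (h : 1 / 3 ≤ x) : eqBidWithout x = x := by
  rcases h.eq_or_lt with rfl | h
  · norm_num [eqBidWithout]
  · exact if_neg (not_le.2 h)

lemma strictMonoOn_eqBidWith : StrictMonoOn eqBidWith (Icc 0 1) := by
  have h1 : StrictMonoOn eqBidWith (Icc 0 (1 / 3)) := by
    intro x hx y hy hxy
    rw [eqBidWith_of_le hx.2, eqBidWith_of_le hy.2]
    exact div_lt_div_of_pos_left (by norm_num) (by linarith [hy.2]) (by linarith)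
  have h2 : StrictMonoOn eqBidWith (Icc (1 / 3) 1) := by
    intro x hx y hy hxy
    rwa [eqBidWith_of_ge hx.1, eqBidWith_of_ge hy.1]
  have := h1.union h2 (c := 1 / 3) ⟨by norm_num, fun x hx => hx.2⟩ ⟨by norm_num, fun x hx => hx.1⟩
  rwa [Icc_union_Icc_eq_Icc (by norm_num) (by norm_num)] at this

lemma strictMonoOn_eqBidWithout : StrictMonoOn eqBidWithout (Icc 0 1) := by
  have h1 : StrictMonoOn eqBidWithout (Icc 0 (1 / 3)) := by
    intro x hx y hy hxy
    rw [eqBidWithout_of_le hx.2, eqBidWithout_of_le hy.2,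
      div_lt_div_iff₀ (by linarith [hx.2]) (by linarith [hy.2])]
    have h4 : 0 < (1 / 3 - x) * (1 - y) := mul_pos (by linarith [hy.2]) (by linarith [hy.2])
    have h3 : 0 < (y - x) * (5 / 9 - x - y + x * y) :=
      mul_pos (by linarith) (by linarith [hy.2])
    nlinarith
  have h2 : StrictMonoOn eqBidWithout (Icc (1 / 3) 1) := by
    intro x hx y hy hxy
    rwa [eqBidWithout_of_ge hx.1, eqBidWithout_of_ge hy.1]
  have := h1.union h2 (c := 1 / 3) ⟨by norm_num, fun x hx => hx.2⟩ ⟨by norm_num, fun x hx => hx.1⟩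
  rwa [Icc_union_Icc_eq_Icc (by norm_num) (by norm_num)] at this

lemma le_eqBidWith (x : ℝ) : x ≤ eqBidWith x := by
  rcases le_total x (1 / 3) with h | h
  · rw [eqBidWith_of_le h, le_div_iff₀ (by linarith)]; nlinarith
  · exact (eqBidWith_of_ge h).ge

lemma le_eqBidWithout (x : ℝ) : x ≤ eqBidWithout x := by
  rcases le_total x (1 / 3) with h | h
  · rw [eqBidWithout_of_le h, le_div_iff₀ (by linarith)]; nlinarith
  · exact (eqBidWithout_of_ge h).ge

lemma eqBidWith_le {x : ℝ} (h : x ≤ 1 / 3) : eqBidWith x ≤ 1 / 3 := by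
  rw [eqBidWith_of_le h, div_le_iff₀ (by linarith)]; linarith

lemma eqBidWithout_le {x : ℝ} (h0 : 0 ≤ x) (h : x ≤ 1 / 3) : eqBidWithout x ≤ 1 / 3 := by
  have := strictMonoOn_eqBidWithout.monotoneOn ⟨h0, by linarith⟩ (b := 1 / 3)
    ⟨by norm_num, by norm_num⟩ h
  rwa [eqBidWithout_of_ge le_rfl] at this

/-- Without the speculator the seller bids are mutual best responses. -/
lemma isBestBid_eqBidWithout {v x : ℝ} (hv : v ∈ Icc (0 : ℝ) (1 / 3)) (hx : x ∈ Icc v 1) :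
    IsBestBid (duelPayoff (1 / 3) ((unif v).map eqBidWithout) x) (eqBidWithout x) := by
  have hv1 : v < 1 := by linarith [hv.2]
  have := isProbabilityMeasure_unif hv1
  have : IsProbabilityMeasure ((unif v).map eqBidWithout) :=
    Measure.isProbabilityMeasure_map measurable_eqBidWithout.aemeasurable
  rcases le_total (1 / 3) x with h3 | h3
  · rw [eqBidWithout_of_ge h3]; exact isBestBid_self _ (by norm_num) h3
  -- The payoff of `x` from imitating `y` is a concave quadratic in `y`, maximal at `y = x`. Bids
  -- below the range win no more often than its lowest bid, and bids above 1/3 lose.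
  have hpay : ∀ y ∈ Icc v (1 / 3), duelPayoff (1 / 3) ((unif v).map eqBidWithout) x (eqBidWithout y)
      = ((5 / 9 - y ^ 2) / 2 - x * (1 - y)) / (1 - v) := by
    intro y hy
    rw [duelPayoff, winProb_map_unif measurable_eqBidWithout strictMonoOn_eqBidWithout hv.1 hv1
      ⟨hy.1, by linarith [hy.2]⟩ (eqBidWithout_le (hv.1.trans hy.1) hy.2),
      eqBidWithout_of_le hy.2]
    have : 1 - y ≠ 0 := by linarith [hy.2]
    field_simp
  have hopt : ∀ y ∈ Icc v (1 / 3), duelPayoff (1 / 3) ((unif v).map eqBidWithout) x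
      (eqBidWithout y) ≤ duelPayoff (1 / 3) ((unif v).map eqBidWithout) x (eqBidWithout x) := by
    intro y hy
    rw [hpay y hy, hpay x ⟨hx.1, h3⟩]
    exact div_le_div_of_nonneg_right (by nlinarith [sq_nonneg (x - y)]) (by linarith)
  refine ⟨(hv.1.trans hx.1).trans (le_eqBidWithout x), fun b _ => ?_⟩
  rcases lt_or_ge b (eqBidWithout v) with hb | hb
  · rcases le_total b x with hbx | hbx
    · exact (mul_nonpos_of_nonpos_of_nonneg (by linarith) (winProb_nonneg _ _ _)).trans
        (mul_nonneg (by linarith [le_eqBidWithout x]) (winProb_nonneg _ _ _))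
    refine le_trans ?_ (hopt v ⟨le_rfl, hv.2⟩)
    rw [duelPayoff, duelPayoff, winProb_map_unif measurable_eqBidWithout strictMonoOn_eqBidWithout
      hv.1 hv1 ⟨le_rfl, hv1.le⟩ (eqBidWithout_le hv.1 hv.2), div_self (by linarith), mul_one]
    exact (mul_le_of_le_one_right (by linarith) (winProb_le_one _ _ _)).trans (by linarith)
  rcases le_or_gt b (1 / 3) with hb3 | hb3
  · have hcont : ContinuousOn eqBidWithout (Icc v (1 / 3)) := by
      refine ContinuousOn.congr (f := fun x => (5 / 9 - x ^ 2) / (2 * (1 - x))) ?_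
        fun y hy => eqBidWithout_of_le hy.2
      refine ContinuousOn.div (by fun_prop) (by fun_prop) fun y hy => ?_
      have := hy.2
      intro h0; linarith
    obtain ⟨y, hy, rfl⟩ := intermediate_value_Icc hv.2 hcont
      ⟨hb, by rwa [eqBidWithout_of_ge le_rfl]⟩
    exact hopt y hy
  · rw [duelPayoff, winProb_of_lt hb3, mul_zero]
    exact mul_nonneg (by linarith [le_eqBidWithout x]) (winProb_nonneg _ _ _)

/-- The speculator is indifferent between all bids from the lowest seller bid to the reserve. -/
lemma isBestBid_spec {v b : ℝ} (hv : v ∈ Icc (0 : ℝ) (1 / 3)) (hb : b ∈ Icc (eqBidWith v) (1 / 3)) :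
    IsBestBid (duelPayoff (1 / 3) ((unif v).map eqBidWith) 0) b ∧
      duelPayoff (1 / 3) ((unif v).map eqBidWith) 0 b = eqBidWith v := by
  have hv1 : v < 1 := by linarith [hv.2]
  have := isProbabilityMeasure_unif hv1
  have : IsProbabilityMeasure ((unif v).map eqBidWith) :=
    Measure.isProbabilityMeasure_map measurable_eqBidWith.aemeasurable
  have hk : 0 < eqBidWith v := by
    rw [eqBidWith_of_le hv.2]; exact div_pos (by norm_num) (by linarith)
  have hval : ∀ b ∈ Icc (eqBidWith v) (1 / 3),
      duelPayoff (1 / 3) ((unif v).map eqBidWith) 0 b = eqBidWith v := by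
    intro b hb
    have hb0 : 0 < b := hk.trans_le hb.1
    have h1 := hb.1
    rw [eqBidWith_of_le hv.2, div_le_iff₀ (by linarith)] at h1
    -- `1 - 2 / (9 * b)` is the type that bids `b`.
    have hy : 1 - 2 / (9 * b) ≤ 1 / 3 := by
      have : 2 / 3 ≤ 2 / (9 * b) := by
        rw [div_le_div_iff₀ (by norm_num) (by linarith)]; linarith [hb.2]
      linarith
    have hy2 : v ≤ 1 - 2 / (9 * b) := by
      have : 2 / (9 * b) ≤ 1 - v := by
        rw [div_le_iff₀ (by linarith)]; linarith
      linarith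
    have hyb : eqBidWith (1 - 2 / (9 * b)) = b := by
      rw [eqBidWith_of_le hy]; field_simp; ring
    have h2 := winProb_map_unif (r := 1 / 3) measurable_eqBidWith strictMonoOn_eqBidWith hv.1 hv1
      (y := 1 - 2 / (9 * b)) ⟨hy2, by linarith⟩ (by rw [hyb]; exact hb.2)
    rw [hyb] at h2
    rw [duelPayoff, h2, eqBidWith_of_le hv.2]
    have : 1 - v ≠ 0 := by linarith
    field_simp
    ring
  refine ⟨⟨hk.le.trans hb.1, fun b' hb' => ?_⟩, hval b hb⟩
  rw [hval b hb]
  rcases lt_or_ge b' (eqBidWith v) with h | h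
  · rw [duelPayoff, sub_zero]
    exact (mul_le_of_le_one_right hb' (winProb_le_one _ _ _)).trans h.le
  rcases le_or_gt b' (1 / 3) with h3 | h3
  · exact (hval b' ⟨h, h3⟩).le
  · rw [duelPayoff, winProb_of_lt h3, mul_zero]; exact hk.le

/-! ### The mixed bid of the speculator -/

/-- The tail H of the speculator's mixture. The first-order condition for (t-x)H(t) at t =
2/(9(1-x)) reads H'/H = -t/((1/3-t)(2/3-t)), which is solved by multiples of (1/3-t)/(2/3-t)². -/
lemma lintegral_specDensity {C t : ℝ} (hC : 0 ≤ C) (ht : 0 ≤ t) (ht3 : t ≤ 1 / 3) :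
    ∫⁻ x in Ioc t (1 / 3), ENNReal.ofReal (C * (x / (2 / 3 - x) ^ 3)) =
      ENNReal.ofReal (C * ((1 / 3 - t) / (2 / 3 - t) ^ 2)) := by
  have hne : ∀ x ∈ uIcc t (1 / 3), 2 / 3 - x ≠ 0 := fun x hx => by
    rw [uIcc_of_le ht3] at hx; have := hx.2; intro h0; linarith
  have hcont : ContinuousOn (fun x : ℝ => C * (x / (2 / 3 - x) ^ 3)) (uIcc t (1 / 3)) :=
    continuousOn_const.mul (continuousOn_id.div (by fun_prop) fun x hx => pow_ne_zero 3 (hne x hx))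
  have hint := hcont.intervalIntegrable (μ := volume)
  have hftc := intervalIntegral.integral_eq_sub_of_hasDerivAt
    (f := fun x : ℝ => C * (-((1 / 3 - x) / (2 / 3 - x) ^ 2))) (a := t) (b := 1 / 3)
    (f' := fun x => C * (x / (2 / 3 - x) ^ 3)) (fun x hx => by
      have h0 := hne x hx
      have h1 := (((hasDerivAt_id x).const_sub (1 / 3)).div
        (((hasDerivAt_id x).const_sub (2 / 3)).pow 2) (pow_ne_zero 2 h0)).neg.const_mul C
      refine HasDerivAt.congr_deriv h1 ?_
      simp only [id, Pi.pow_apply]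
      push_cast
      field_simp
      ring) hint
  rw [intervalIntegral.integral_of_le ht3] at hftc
  rw [← ofReal_integral_eq_lintegral_ofReal, hftc]
  · congr 1; simp
  · exact (intervalIntegrable_iff_integrableOn_Ioc_of_le ht3).1 hint
  · refine (ae_restrict_mem measurableSet_Ioc).mono fun x hx => ?_
    have h1 := hx.1; have h2 := hx.2
    exact mul_nonneg hC (div_nonneg (by linarith) (pow_nonneg (by linarith) 3))

/-- A mixed bid of the speculator against which the seller bids are optimal. -/
lemma exists_specBid {v : ℝ} (hv : v ∈ Icc (0 : ℝ) (1 / 3)) :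
    ∃ σ : Measure ℝ, IsProbabilityMeasure σ ∧ (∀ᵐ b ∂σ, b ∈ Icc (eqBidWith v) (1 / 3)) ∧
      (∀ x ∈ Icc v 1, IsBestBid (duelPayoff (1 / 3) σ x) (eqBidWith x)) ∧
      duelPayoff (1 / 3) σ v (eqBidWith v) = eqBidWith v - v := by
  rcases hv.2.eq_or_lt with rfl | hlt
  -- At cutoff 1/3 the bid interval shrinks to a point and the density degenerates.
  · refine ⟨Measure.dirac (1 / 3), inferInstance, ?_, ?_, ?_⟩
    · exact (ae_dirac_iff measurableSet_Icc).2 (by rw [eqBidWith_of_ge le_rfl]; simp)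
    · intro x hx
      rw [eqBidWith_of_ge hx.1]; exact isBestBid_self _ (by norm_num) hx.1
    · rw [duelPayoff, eqBidWith_of_ge le_rfl]; simp
  set k := eqBidWith v with hk
  have hkv : k * (1 - v) = 2 / 9 := by
    have : 1 - v ≠ 0 := by linarith
    rw [hk, eqBidWith_of_le hv.2]; field_simp
  have hk0 : 0 < k := by
    rw [hk, eqBidWith_of_le hv.2]; exact div_pos (by norm_num) (by linarith)
  have hk3 : k < 1 / 3 := by
    rw [hk, eqBidWith_of_le hv.2, div_lt_iff₀ (by linarith)]; linarith
  -- Normalises the tail to 1 at the lowest bid `k`.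
  set C := (2 / 3 - k) ^ 2 / (1 / 3 - k) with hCdef
  have hC : 0 < C := div_pos (pow_pos (by linarith) 2) (by linarith)
  have hCk : C * ((1 / 3 - k) / (2 / 3 - k) ^ 2) = 1 := by
    have h1 : 1 / 3 - k ≠ 0 := by linarith
    have h2 : 2 / 3 - k ≠ 0 := by linarith
    rw [hCdef, div_mul_div_comm, mul_comm, div_self (mul_ne_zero h1 (pow_ne_zero 2 h2))]
  set σ : Measure ℝ := (volume.restrict (Ioc k (1 / 3))).withDensity
    (fun x => ENNReal.ofReal (C * (x / (2 / 3 - x) ^ 3))) with hσ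
  have hσp : IsProbabilityMeasure σ := by
    refine ⟨?_⟩
    rw [hσ, withDensity_apply _ MeasurableSet.univ, Measure.restrict_univ,
      lintegral_specDensity hC.le hk0.le hk3.le, hCk, ENNReal.ofReal_one]
  have hac : σ ≪ volume.restrict (Ioc k (1 / 3)) := withDensity_absolutelyContinuous _ _
  have hwin : ∀ t ∈ Icc k (1 / 3), winProb (1 / 3) σ t = C * ((1 / 3 - t) / (2 / 3 - t) ^ 2) := by
    intro t ht
    have h1 : σ {t} = 0 := hac (measure_singleton t)
    have h2 : Ioi t ∩ Ioc k (1 / 3) = Ioc t (1 / 3) := by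
      ext x; have := ht.1; simp only [mem_inter_iff, mem_Ioi, mem_Ioc]; grind
    rw [winProb, if_pos ht.2, Measure.real, Measure.real, h1, hσ,
      withDensity_apply _ measurableSet_Ioi, Measure.restrict_restrict measurableSet_Ioi, h2,
      lintegral_specDensity hC.le (hk0.le.trans ht.1) ht.2, ENNReal.toReal_ofReal]
    · simp
    · exact mul_nonneg hC.le (div_nonneg (by linarith [ht.2]) (sq_nonneg _))
  have hwk : winProb (1 / 3) σ k = 1 := by rw [hwin k ⟨le_rfl, hk3.le⟩, hCk]
  refine ⟨σ, hσp, ?_, fun x hx => ?_, ?_⟩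
  · filter_upwards [hac.ae_le (ae_restrict_mem measurableSet_Ioc)] with b hb
    exact ⟨hb.1.le, hb.2⟩
  · rcases le_total (1 / 3) x with h3 | h3
    · rw [eqBidWith_of_ge h3]; exact isBestBid_self _ (by norm_num) h3
    have hx0 : 0 ≤ x := hv.1.trans hx.1
    have hβx : k ≤ eqBidWith x :=
      strictMonoOn_eqBidWith.monotoneOn ⟨hv.1, by linarith⟩ ⟨hx0, hx.2⟩ hx.1
    have hpay : duelPayoff (1 / 3) σ x (eqBidWith x) =
        C * (3 * (1 / 3 - x) ^ 2 / (4 * (2 / 3 - x))) := by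
      rw [duelPayoff, hwin _ ⟨hβx, eqBidWith_le h3⟩, eqBidWith_of_le h3]
      have h1 : 1 - x ≠ 0 := by linarith
      have h2 : 2 / 3 - x ≠ 0 := by linarith
      have h4 : 2 / 3 - 2 / (9 * (1 - x)) = 2 * (2 / 3 - x) / (3 * (1 - x)) := by
        field_simp; ring
      have h5 : 1 / 3 - 2 / (9 * (1 - x)) = (1 / 3 - x) / (3 * (1 - x)) := by
        field_simp; ring
      have h6 : 2 / (9 * (1 - x)) - x = (1 / 3 - x) * (2 / 3 - x) / (1 - x) := by
        field_simp; ring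
      rw [h4, h5, h6]
      generalize 2 / 3 - x = A at *
      generalize 1 / 3 - x = B at *
      generalize 1 - x = D at *
      field_simp
      ring
    have hopt : ∀ t ∈ Icc k (1 / 3), duelPayoff (1 / 3) σ x t ≤
        duelPayoff (1 / 3) σ x (eqBidWith x) := by
      intro t ht
      rw [hpay, duelPayoff, hwin t ht, mul_left_comm]
      refine mul_le_mul_of_nonneg_left ?_ hC.le
      have h1 : 0 < 2 / 3 - t := by linarith [ht.2]
      rw [← mul_div_assoc, div_le_div_iff₀ (by positivity) (by linarith)]
      -- The difference of the two sides is three times this square, which vanishes at `t =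
      -- eqBidWith x`.
      nlinarith [sq_nonneg (t * (1 - x) - 2 / 9)]
    have hopt0 : 0 ≤ duelPayoff (1 / 3) σ x (eqBidWith x) :=
      mul_nonneg (by linarith [le_eqBidWith x]) (winProb_nonneg _ _ _)
    refine ⟨hx0.trans (le_eqBidWith x), fun b _ => ?_⟩
    rcases lt_or_ge b k with hb | hb
    · rcases le_total b x with hbx | hbx
      · exact (mul_nonpos_of_nonpos_of_nonneg (by linarith) (winProb_nonneg _ _ _)).trans hopt0
      · refine le_trans ?_ (hopt k ⟨le_rfl, hk3.le⟩)
        rw [duelPayoff, duelPayoff, hwk, mul_one]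
        exact (mul_le_of_le_one_right (by linarith) (winProb_le_one _ _ _)).trans (by linarith)
    rcases le_or_gt b (1 / 3) with hb3 | hb3
    · exact hopt b ⟨hb, hb3⟩
    · rw [duelPayoff, winProb_of_lt hb3, mul_zero]; exact hopt0
  · rw [duelPayoff, hwk, mul_one]

/-! ### Price and profit as functions of the cutoff -/

lemma cdf_unif_zero {x : ℝ} (hx : x ∈ Icc (0 : ℝ) 1) : cdf (unif 0) x = x := by
  rw [cdf_eq_real, measureReal_congr Iio_ae_eq_Iic.symm, unif_zero_real_Iio hx.1 hx.2]

/-- The objective b(1-b)/(1-v) increases on `[v, 1/3]`, so the maximum is at the reserve price. -/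
lemma lowBid_unif_zero {v : ℝ} (hv : v ∈ Icc (0 : ℝ) (1 / 3)) :
    lowBid (unif 0) (1 / 3) 1 v = eqBidWith v := by
  have hv1 : 0 < 1 - v := by linarith [hv.2]
  have hval : ∀ b ∈ Icc v (1 / 3), b * (1 - condCDFAbove (unif 0) v b) ^ 1
      = b * (1 - b) / (1 - v) := by
    intro b hb
    rw [condCDFAbove, cdf_unif_zero ⟨hv.1.trans hb.1, by linarith [hb.2]⟩,
      cdf_unif_zero ⟨hv.1, by linarith⟩]
    field_simp
    ring
  have hgr : IsGreatest ((fun b => b * (1 - condCDFAbove (unif 0) v b) ^ 1) '' Icc v (1 / 3))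
      (eqBidWith v) := by
    have hr : eqBidWith v = 1 / 3 * (1 - 1 / 3) / (1 - v) := by
      rw [eqBidWith_of_le hv.2]; field_simp; norm_num
    rw [hr]
    refine ⟨⟨1 / 3, ⟨hv.2, le_rfl⟩, hval _ ⟨hv.2, le_rfl⟩⟩, ?_⟩
    rintro _ ⟨b, hb, rfl⟩
    dsimp only
    rw [hval b hb]
    exact div_le_div_of_nonneg_right (by nlinarith [hb.2]) hv1.le
  exact hgr.csSup_eq

lemma cutoffPrice_unif_zero {v : ℝ} (hv : v ∈ Icc (0 : ℝ) (1 / 3)) :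
    cutoffPrice 2 (unif 0) (1 / 3) v =
      v + ((1 - v) ^ 2 - 4 / 9) / 2 + v * (eqBidWith v - v) := by
  have hint : ∫ x in v..(1 / 3), (1 - cdf (unif 0) x) ^ (2 - 1) = ((1 - v) ^ 2 - 4 / 9) / 2 := by
    rw [intervalIntegral.integral_congr (g := fun x => 1 - x)]
    · rw [intervalIntegral.integral_sub (by simp) (by simp)]
      simp
      ring
    · intro x hx
      rw [uIcc_of_le hv.2] at hx
      simp [cdf_unif_zero ⟨hv.1.trans hx.1, by linarith [hx.2]⟩]
  rw [cutoffPrice, hint]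
  simp [-one_div, lowBid_unif_zero hv, cdf_unif_zero ⟨hv.1, by linarith [hv.2]⟩]

lemma cutoffProfit_unif_zero {v : ℝ} (hv : v ∈ Icc (0 : ℝ) (1 / 3)) :
    cutoffProfit 2 (unif 0) (1 / 3) v =
      2 * (1 - v) * v * eqBidWith v + v ^ 2 * (1 / 3)
        - 2 * v * cutoffPrice 2 (unif 0) (1 / 3) v := by
  rw [cutoffProfit, cdf_unif_zero ⟨hv.1, by linarith [hv.2]⟩]
  simp [-one_div, lowBid_unif_zero hv]

lemma eqBidWith_mul {v : ℝ} (hv : v ≤ 1 / 3) : eqBidWith v * (1 - v) = 2 / 9 := by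
  have : 1 - v ≠ 0 := by linarith
  rw [eqBidWith_of_le hv]; field_simp

lemma cutoffProfit_neg {v : ℝ} (hv : v ∈ Ioc (0 : ℝ) (1 / 3)) :
    cutoffProfit 2 (unif 0) (1 / 3) v < 0 := by
  have hvI : v ∈ Icc (0 : ℝ) (1 / 3) := ⟨hv.1.le, hv.2⟩
  rw [cutoffProfit_unif_zero hvI, cutoffPrice_unif_zero hvI]
  have hk := eqBidWith_mul hv.2
  have hk3 := eqBidWith_le hv.2
  obtain ⟨h0, h3⟩ := hv
  set k := eqBidWith v
  have h1 : 2 * (1 - v) * v * k + v ^ 2 * (1 / 3)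
      - 2 * v * (v + ((1 - v) ^ 2 - 4 / 9) / 2 + v * (k - v)) =
      v * (8 / 9 - 2 * (v * k) + v / 3 - 1 + v ^ 2) := by linear_combination 2 * v * hk
  have hvk : v * k = k - 2 / 9 := by linarith
  -- From 1/(1-v) ≥ 1+v. The bracket is then at most v² - v/9 - 1/9, negative on `[0, 1/3]`.
  have hk9 : 2 / 9 + 2 / 9 * v ≤ k := by nlinarith
  rw [h1]
  refine mul_neg_of_pos_of_neg h0 ?_
  nlinarith

lemma cutoffPrice_mem {v : ℝ} (hv : v ∈ Icc (0 : ℝ) (1 / 3)) :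
    cutoffPrice 2 (unif 0) (1 / 3) v ∈ Icc (0 : ℝ) (1 / 3) := by
  rw [cutoffPrice_unif_zero hv]
  have hk := eqBidWith_mul hv.2
  have hk3 := eqBidWith_le hv.2
  have hkv := le_eqBidWith v
  obtain ⟨h0, h3⟩ := hv
  set k := eqBidWith v
  have hvk : v * k = k - 2 / 9 := by linarith
  have h1 : (1 - v) * (v + ((1 - v) ^ 2 - 4 / 9) / 2 + v * (k - v)) =
      (1 - v) * (5 / 18 - v ^ 2 / 2) + 2 / 9 * v := by linear_combination v * hk
  constructor
  · have := mul_nonneg h0 (sub_nonneg.2 hkv)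
    nlinarith
  · by_contra! hlt
    have h2 := mul_lt_mul_of_pos_left hlt (by linarith : 0 < 1 - v)
    rw [h1] at h2
    nlinarith [mul_nonneg h0 (sub_nonneg.2 h3), mul_nonneg (mul_nonneg h0 h0) (sub_nonneg.2 h3)]

/-- Intermediate values: the price is continuous in the cutoff and equals 1/3 at cutoff 1/3. -/
lemma exists_cutoffPrice_eq {p : ℝ} (h : cutoffPrice 2 (unif 0) (1 / 3) 0 ≤ p) (hp : p ≤ 1 / 3) :
    ∃ v ∈ Icc (0 : ℝ) (1 / 3), cutoffPrice 2 (unif 0) (1 / 3) v = p := by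
  have hcont : ContinuousOn (cutoffPrice 2 (unif 0) (1 / 3)) (Icc 0 (1 / 3)) := by
    refine ContinuousOn.congr (f := fun v => v + ((1 - v) ^ 2 - 4 / 9) / 2
      + v * (2 / (9 * (1 - v)) - v)) ?_ fun v hv => ?_
    · have : ContinuousOn (fun v : ℝ => 2 / (9 * (1 - v))) (Icc 0 (1 / 3)) := by
        refine ContinuousOn.div (by fun_prop) (by fun_prop) fun y hy => ?_
        have := hy.2
        intro h0; linarith
      fun_prop
    · rw [cutoffPrice_unif_zero hv, eqBidWith_of_le hv.2]
  have h3 : cutoffPrice 2 (unif 0) (1 / 3) (1 / 3) = 1 / 3 := by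
    rw [cutoffPrice_unif_zero ⟨by norm_num, le_rfl⟩, eqBidWith_of_ge le_rfl]; norm_num
  exact intermediate_value_Icc (by norm_num) hcont ⟨h, by rwa [h3]⟩

/-! ### Existence of cutoff equilibria -/

/-- The assessment with cutoff `v` in which the speculator bids according to `σ` against one
seller. -/
noncomputable def cutoffAssessment (v : ℝ) (σ : Measure ℝ) : Assessment where
  accept x := if x < v then 1 else 0
  bidWith _ := eqBidWith
  bidWithout := eqBidWithout
  specBid m := if m = 1 then σ else Measure.dirac (1 / 3)
  belief := unif v

lemma hasCutoff_cutoffAssessment (v : ℝ) (σ F : Measure ℝ) :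
    (cutoffAssessment v σ).HasCutoff F v := .of_forall fun _ => rfl

lemma rejectValue_cutoffAssessment {v : ℝ} {σ : Measure ℝ} [IsProbabilityMeasure σ]
    (hv : v ∈ Icc (0 : ℝ) (1 / 3))
    (hσ : IsBestBid (duelPayoff (1 / 3) σ v) (eqBidWith v))
    (hσ' : duelPayoff (1 / 3) σ v (eqBidWith v) = eqBidWith v - v) :
    (cutoffAssessment v σ).rejectValue 2 (unif 0) (1 / 3) v =
      cutoffPrice 2 (unif 0) (1 / 3) v - v := by
  have hv1 : v < 1 := by linarith [hv.2]
  have : IsProbabilityMeasure (cutoffAssessment v σ).belief := isProbabilityMeasure_unif hv1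
  have : IsProbabilityMeasure ((cutoffAssessment v σ).specBid 1) := by
    simpa [cutoffAssessment] using ‹IsProbabilityMeasure σ›
  rw [Assessment.rejectValue_two _ _ _ _ measurable_eqBidWithout,
    (hasCutoff_cutoffAssessment v σ _).acceptProb_eq ⟨hv.1, hv1.le⟩, cutoffPrice_unif_zero hv]
  have h1 : bestPayoff (duelPayoff (1 / 3) ((cutoffAssessment v σ).specBid 1) v)
      = eqBidWith v - v := by
    rw [← hσ', ← hσ.bestPayoff_eq]; simp [cutoffAssessment]
  have h2 : bestPayoff (duelPayoff (1 / 3)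
      ((cutoffAssessment v σ).belief.map (cutoffAssessment v σ).bidWithout) v)
      = eqBidWithout v - v := by
    refine (isBestBid_eqBidWithout hv ⟨le_rfl, hv1.le⟩).bestPayoff_eq.trans ?_
    rw [duelPayoff, winProb_map_unif measurable_eqBidWithout strictMonoOn_eqBidWithout hv.1 hv1
      ⟨le_rfl, hv1.le⟩ (eqBidWithout_le hv.1 hv.2), div_self (by linarith), mul_one]
  have h3 : (1 - v) * eqBidWithout v = (5 / 9 - v ^ 2) / 2 := by
    have : 1 - v ≠ 0 := by linarith
    rw [eqBidWithout_of_le hv.2]; field_simp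
  rw [h1, h2]
  linear_combination h3

/-- Single crossing: the reject value falls at rate at most one and the accept payoff at rate
exactly one, so the acceptance decision need only be checked at the cutoff type. -/
lemma rejectValue_le_add {s : Assessment} {F : Measure ℝ} {r x y : ℝ}
    [IsProbabilityMeasure (s.specBid 1)] [IsProbabilityMeasure s.belief]
    (hm : Measurable s.bidWithout) (ha : s.acceptProb F ∈ Icc (0 : ℝ) 1) (hr : 0 ≤ r) (hx : 0 ≤ x)
    (hxy : x ≤ y) : s.rejectValue 2 F r x ≤ s.rejectValue 2 F r y + (y - x) := by
  have : IsProbabilityMeasure (s.belief.map s.bidWithout) :=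
    Measure.isProbabilityMeasure_map hm.aemeasurable
  rw [Assessment.rejectValue_two _ _ _ _ hm, Assessment.rejectValue_two _ _ _ _ hm]
  have h1 := mul_le_mul_of_nonneg_left
    (bestPayoff_le_add (ν := s.specBid 1) hr hx hxy) ha.1
  have h2 := mul_le_mul_of_nonneg_left
    (bestPayoff_le_add (ν := s.belief.map s.bidWithout) hr hx hxy) (sub_nonneg.2 ha.2)
  linarith

/-- A positive cutoff requires the indifference price; at cutoff 0 nobody accepts, so every lower
price works as well. -/
lemma exists_isSymmetricPBE {v p : ℝ} (hv : v ∈ Icc (0 : ℝ) (1 / 3))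
    (hp : p ≤ cutoffPrice 2 (unif 0) (1 / 3) v)
    (hp' : 0 < v → cutoffPrice 2 (unif 0) (1 / 3) v ≤ p) :
    ∃ s : Assessment, s.IsSymmetricPBE 2 (unif 0) (1 / 3) p ∧ s.HasCutoff (unif 0) v ∧
      s.specProfit 2 (unif 0) (1 / 3) (cutoffPrice 2 (unif 0) (1 / 3) v) =
        cutoffProfit 2 (unif 0) (1 / 3) v := by
  obtain ⟨σ, hσp, hσs, hσb, hσv⟩ := exists_specBid hv
  have hv1 : v < 1 := by linarith [hv.2]
  have hvI : v ∈ Icc v 1 := ⟨le_rfl, hv1.le⟩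
  set s := cutoffAssessment v σ with hs
  have hc : s.HasCutoff (unif 0) v := hasCutoff_cutoffAssessment v σ _
  have hbp : IsProbabilityMeasure s.belief := isProbabilityMeasure_unif hv1
  have hs1 : s.specBid 1 = σ := by simp [hs, cutoffAssessment]
  have hs0 : s.specBid 0 = Measure.dirac (1 / 3) := by simp [hs, cutoffAssessment]
  have hsp : IsProbabilityMeasure (s.specBid 1) := by rwa [hs1]
  have hap : s.acceptProb (unif 0) = v := hc.acceptProb_eq ⟨hv.1, hv1.le⟩
  have hapm : s.acceptProb (unif 0) ∈ Icc (0 : ℝ) 1 := by rw [hap]; exact ⟨hv.1, hv1.le⟩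
  have hrej : s.rejectValue 2 (unif 0) (1 / 3) v = cutoffPrice 2 (unif 0) (1 / 3) v - v :=
    rejectValue_cutoffAssessment hv (hσb v hvI) hσv
  have hge : ∀ x, s.accept x < 1 → v ≤ x := fun x hx => by
    by_contra! hlt
    simp [hs, cutoffAssessment, hlt] at hx
  have hpay : specPayoff (1 / 3) s.belief 1 (s.bidWith 1) =
      duelPayoff (1 / 3) ((unif v).map eqBidWith) 0 := funext fun b => by
    rw [specPayoff_one _ _ (show Measurable (s.bidWith 1) from measurable_eqBidWith), duelPayoff,
      sub_zero]
    rfl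
  have hpay0 : specPayoff (1 / 3) s.belief 0 (s.bidWith 0) =
      fun b => if b ≤ 1 / 3 then b else 0 := funext fun b => specPayoff_zero _ _ _ b
  refine ⟨s, ?_, hc, ?_⟩
  · refine
      { measurable_accept := Measurable.ite measurableSet_Iio measurable_const measurable_const
        measurable_bidWith := fun _ => measurable_eqBidWith
        measurable_bidWithout := measurable_eqBidWithout
        prob_specBid := fun m => ?_
        prob_belief := hbp
        accept_mem := fun x _ => ?_
        belief_support := ?_
        bayes := ?_
        accept_optimal := fun x hx hax => ?_
        reject_optimal := fun x hx hax => ?_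
        undominated_with := fun _ _ _ x _ => le_eqBidWith x
        undominated_without := fun x _ => le_eqBidWithout x
        bidWith_optimal := fun k hk x hx hax => ?_
        bidWithout_optimal := fun x hx hax => ?_
        specBid_optimal := fun m hm => ?_ }
    · by_cases hm : m = 1
      · rw [hm]; exact hsp
      · simp only [hs, cutoffAssessment, hm, if_false]; infer_instance
    · simp only [hs, cutoffAssessment]
      split_ifs <;> simp
    · exact measure_mono_null (compl_subset_compl.2 (Icc_subset_Icc_left hv.1)) (ae_unif_mem v)
    · rw [hc.withDensity_eq ⟨hv.1, hv1⟩, hap]; rfl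
    · have hxv : x < v := by
        by_contra! hle
        simp [hs, cutoffAssessment, not_lt.2 hle] at hax
      have h1 := rejectValue_le_add (F := unif 0) (s := s) (r := 1 / 3) measurable_eqBidWithout
        hapm (by norm_num) hx.1 hxv.le
      have h2 := hp' (hx.1.trans_lt hxv)
      linarith
    · have h1 := rejectValue_le_add (F := unif 0) (s := s) (r := 1 / 3) measurable_eqBidWithout
        hapm (by norm_num) hv.1 (hge x hax)
      linarith
    · obtain rfl : k = 0 := by omega
      have : sellerPayoffWith (1 / 3) s.belief (s.specBid (0 + 1)) 0 (s.bidWith (0 + 1)) x =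
          duelPayoff (1 / 3) σ x := funext fun b => by
        rw [sellerPayoffWith_zero, hs1]; rfl
      rw [this]
      exact hσb x ⟨hge x hax, hx.2⟩
    · have : sellerPayoffWithout (1 / 3) s.belief (2 - 1) s.bidWithout x =
          duelPayoff (1 / 3) ((unif v).map eqBidWithout) x := funext fun b =>
        sellerPayoffWithout_one _ _ measurable_eqBidWithout _ _
      rw [this]
      exact isBestBid_eqBidWithout hv ⟨hge x hax, hx.2⟩
    · obtain rfl | rfl : m = 0 ∨ m = 1 := by omega
      · rw [hs0, hpay0, ae_dirac_eq, Filter.eventually_pure]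
        refine ⟨by norm_num, fun b _ => ?_⟩
        dsimp only
        split_ifs <;> linarith
      · rw [hs1, hpay]
        exact hσs.mono fun b hb => (isBestBid_spec hv hb).1
  · have h1 : ∫ b, specPayoff (1 / 3) s.belief 1 (s.bidWith 1) b ∂(s.specBid 1)
        = eqBidWith v := by
      rw [hs1, hpay, integral_congr_ae (hσs.mono fun b hb => (isBestBid_spec hv hb).2)]
      simp
    have h0 : ∫ b, specPayoff (1 / 3) s.belief 0 (s.bidWith 0) b ∂(s.specBid 0) = 1 / 3 := by
      rw [hs0, hpay0, integral_dirac]; simp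
    rw [Assessment.specProfit, hap, Finset.sum_range_succ, Finset.sum_range_one, h1, h0,
      cutoffProfit_unif_zero hv]
    norm_num
    ring

lemma exists_isSymmetricPBE_of_price {p : ℝ} (hp : p ≤ 1 / 3) :
    ∃ s : Assessment, s.IsSymmetricPBE 2 (unif 0) (1 / 3) p := by
  rcases le_total p (cutoffPrice 2 (unif 0) (1 / 3) 0) with h | h
  · obtain ⟨s, hs, -⟩ := exists_isSymmetricPBE (v := 0) ⟨le_rfl, by norm_num⟩ h
      fun h0 => absurd h0 (lt_irrefl _)
    exact ⟨s, hs⟩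
  · obtain ⟨v, hv, rfl⟩ := exists_cutoffPrice_eq h hp
    obtain ⟨s, hs, -⟩ := exists_isSymmetricPBE hv le_rfl fun _ => le_rfl
    exact ⟨s, hs⟩

end FPASpeculation

/-! ### The proposition -/

theorem mainTheorem3 :
    ∃ (η r : ℝ) (F : Measure ℝ),
      0 < η ∧ 0 < r ∧ r ≤ 1 ∧ IsProbabilityMeasure F ∧
      (∀ v ∈ Set.Icc (0 : ℝ) 1, cdf F v = v ^ η) ∧
      -- the profit function is negative at every positive cutoff
      FPASpeculation.cutoffProfit 2 F r 0 = 0 ∧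
      (∀ v ∈ Set.Ioc 0 r, FPASpeculation.cutoffProfit 2 F r v < 0) ∧
      -- it is the speculator's expected profit in a symmetric equilibrium with that cutoff
      (∀ v ∈ Set.Icc 0 r, FPASpeculation.cutoffPrice 2 F r v ∈ Set.Icc 0 r ∧
        ∃ s : FPASpeculation.Assessment,
          s.IsSymmetricPBE 2 F r (FPASpeculation.cutoffPrice 2 F r v) ∧ s.HasCutoff F v ∧
          s.specProfit 2 F r (FPASpeculation.cutoffPrice 2 F r v) =
            FPASpeculation.cutoffProfit 2 F r v) ∧
      -- after every price offer a symmetric equilibrium exists, and every symmetric equilibrium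
      -- is a cutoff equilibrium; the speculator loses whenever the cutoff is positive
      (∀ p ∈ Set.Icc 0 r, (∃ s : FPASpeculation.Assessment, s.IsSymmetricPBE 2 F r p) ∧
        ∀ s : FPASpeculation.Assessment, s.IsSymmetricPBE 2 F r p →
          (∃ v ∈ Set.Icc 0 r, s.HasCutoff F v) ∧
          ∀ v ∈ Set.Icc 0 r, s.HasCutoff F v →
            (v = 0 → s.specProfit 2 F r p = 0) ∧ (0 < v → s.specProfit 2 F r p < 0)) ∧
      -- the optimal expected profit of the speculator is zero
      IsGreatest {π : ℝ | ∃ p ∈ Set.Icc 0 r, ∃ s : FPASpeculation.Assessment,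
        s.IsSymmetricPBE 2 F r p ∧ s.specProfit 2 F r p = π} 0 := by
  have hr : (0 : ℝ) ≤ 1 / 3 := by norm_num
  have hprofit0 : FPASpeculation.cutoffProfit 2 (FPASpeculation.unif 0) (1 / 3) 0 = 0 := by
    rw [FPASpeculation.cutoffProfit_unif_zero ⟨le_rfl, hr⟩]; ring
  have hmain : ∀ p ∈ Set.Icc (0 : ℝ) (1 / 3), ∀ s : FPASpeculation.Assessment,
      s.IsSymmetricPBE 2 (FPASpeculation.unif 0) (1 / 3) p →
        (∃ v ∈ Set.Icc (0 : ℝ) (1 / 3), s.HasCutoff (FPASpeculation.unif 0) v) ∧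
        ∀ v ∈ Set.Icc (0 : ℝ) (1 / 3), s.HasCutoff (FPASpeculation.unif 0) v →
          (v = 0 → s.specProfit 2 (FPASpeculation.unif 0) (1 / 3) p = 0) ∧
          (0 < v → s.specProfit 2 (FPASpeculation.unif 0) (1 / 3) p < 0) := by
    intro p hp s hs
    refine ⟨?_, fun v hv hc => ⟨?_, fun h0 => hs.specProfit_neg hp hc ⟨h0, hv.2⟩⟩⟩
    · obtain ⟨v, hv, hc⟩ := hs.exists_hasCutoff hr hp.1 (by linarith [hp.2])
      exact ⟨v, ⟨hv.1, hv.2.trans hp.2⟩, hc⟩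
    · rintro rfl
      exact hs.specProfit_eq_zero hc
  refine ⟨1, 1 / 3, FPASpeculation.unif 0, one_pos, by norm_num, by norm_num, inferInstance,
    fun v hv => by rw [FPASpeculation.cdf_unif_zero hv, Real.rpow_one], hprofit0,
    fun v hv => FPASpeculation.cutoffProfit_neg hv,
    fun v hv => ⟨FPASpeculation.cutoffPrice_mem hv,
      FPASpeculation.exists_isSymmetricPBE hv le_rfl fun _ => le_rfl⟩,
    fun p hp => ⟨FPASpeculation.exists_isSymmetricPBE_of_price hp.2, hmain p hp⟩, ?_, ?_⟩
  · obtain ⟨s, hs, -, hprofit⟩ := FPASpeculation.exists_isSymmetricPBE (v := 0) ⟨le_rfl, hr⟩ le_rfl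
      fun _ => le_rfl
    exact ⟨_, FPASpeculation.cutoffPrice_mem ⟨le_rfl, hr⟩, s, hs, hprofit.trans hprofit0⟩
  · rintro π ⟨p, hp, s, hs, rfl⟩
    obtain ⟨⟨v, hv, hc⟩, h⟩ := hmain p hp s hs
    rcases hv.1.eq_or_lt with h0 | h0
    · exact ((h v hv hc).1 h0.symm).le
    · exact ((h v hv hc).2 h0).le
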